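/- Let $K$ be an algebraically closed field of characteristic $0$, let $n\ge 0$ and $d\ge 1$, and let $X=V(f)\subset\mathbb P^{n+1}_K$ be a smooth hypersurface, where $f\neq 0$ is homogeneous of degree $d$; write $i:X\to\mathbb P^{n+1}$ for the inclusion. For $j\ge 0$ let $X_j=V(f^j)\subset \mathbb P^{n+1}$ be the $j$-th thickening of $X$ (so $X_1=X$ and $X_0=\emptyset$). Let $E$ be an arithmetically Cohen–Macaulay vector bundle on $X$, i.e. a locally free sheaf of finite constant rank with $H^q(X,E(l))=0$ for all $l\in\mathbb Z$ and $0<q<n$. Let $$0\to\widetilde F_t\to\cdots\to\widetilde F_1\xrightarrow{\ \phi\ }\widetilde F_0\to i_*E\to 0$$ be a minimal free resolution of $E$ on $\mathbb P^{n+1}$: an exact sequence in which every $\widetilde F_j$ is a finite direct sum of line bundles $\mathcal O_{\mathbb P^{n+1}}(a)$ and no entry of the matrix of any $\widetilde F_{j+1}\to\widetilde F_j$ is a nonzero constant. Let $E^\sigma=\operatorname{Ker}(\widetilde F_0|_X\to E)$, a vector bundle on $X$, and let $k$ be an integer with $1\le k\le\min\{\operatorname{rank}E,\operatorname{rank}E^\sigma\}$.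 Put $$\mathcal F_k=\operatorname{Coker}\bigl(\wedge^k\phi:\wedge^k\widetilde F_1\to\wedge^k\widetilde F_0\bigr),\qquad \mathcal F_k|_{X_{k-1}}=\mathcal F_k\otimes_{\mathcal O_{\mathbb P^{n+1}}}\mathcal O_{X_{k-1}} .$$ Then there is a short exact sequence of sheaves of $\mathcal O_{\mathbb P^{n+1}}$-modules $$0\to (\wedge^kE)(-(k-1)d)\to\mathcal F_k\to\mathcal F_k|_{X_{k-1}}\to 0,$$ in which $\wedge^kE$ is regarded as a sheaf on $\mathbb P^{n+1}$ via $i_*$ and the second map is the canonical restriction map. -/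

import Mathlib

open CategoryTheory AlgebraicGeometry Opposite TopologicalSpace Limits

universe u v w

noncomputable section

section ExteriorPower

namespace PresheafOfModules

variable {C : Type w} [Category.{v} C] {R : Cᵒᵖ ⥤ CommRingCat.{u}}

/-- The restriction map `⋀ᵏ P(U) ⟶ ⋀ᵏ P(V)` of the exterior power of a presheaf of modules. -/
def exteriorRes (P : PresheafOfModules.{u} (R ⋙ forget₂ CommRingCat RingCat)) (k : ℕ) {U V : Cᵒᵖ} (f : U ⟶ V) :
    ModuleCat.exteriorPower (R := R.obj U) (P.obj U) k ⟶
      (ModuleCat.restrictScalars (R.map f).hom).obj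
        (ModuleCat.exteriorPower (R := R.obj V) (P.obj V) k) :=
  ModuleCat.exteriorPower.desc (R := R.obj U) (M := P.obj U)
    (N := (ModuleCat.restrictScalars (R.map f).hom).obj
        (ModuleCat.exteriorPower (R := R.obj V) (P.obj V) k))
    { toFun := fun m => exteriorPower.ιMulti (R.obj V) k (fun i => P.restrictₛₗ f (m i))
      map_update_add' := by
        intro _ m i x y
        have h : ∀ z, (fun j => P.restrictₛₗ f (Function.update m i z j)) =
            Function.update (fun j => P.restrictₛₗ f (m j)) i (P.restrictₛₗ f z) := fun z =>
          funext (Function.apply_update (fun _ t => P.restrictₛₗ f t) m i z)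
        simp only [h, map_add]
        exact (exteriorPower.ιMulti (R.obj V) k).map_update_add _ i _ _
      map_update_smul' := by
        intro _ m i r x
        have h : ∀ z, (fun j => P.restrictₛₗ f (Function.update m i z j)) =
            Function.update (fun j => P.restrictₛₗ f (m j)) i (P.restrictₛₗ f z) := fun z =>
          funext (Function.apply_update (fun _ t => P.restrictₛₗ f t) m i z)
        have e : P.restrictₛₗ f (r • x) = (R.map f).hom r • P.restrictₛₗ f x := P.map_smul f r x
        simp only [h, e]
        exact (exteriorPower.ιMulti (R.obj V) k).map_update_smul _ i _ _
      map_eq_zero_of_eq' := by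
        intro m i j h hij
        exact (exteriorPower.ιMulti (R.obj V) k).map_eq_zero_of_eq
          (fun i => P.restrictₛₗ f (m i)) (congrArg (P.restrictₛₗ f) h) hij }

lemma exteriorRes_ιMulti (P : PresheafOfModules.{u} (R ⋙ forget₂ CommRingCat RingCat)) (k : ℕ) {U V : Cᵒᵖ} (f : U ⟶ V) (m : Fin k → P.obj U) :
   exteriorRes P k f (exteriorPower.ιMulti (R.obj U) (M := P.obj U) k m) =
     exteriorPower.ιMulti (R.obj V) k (fun i => P.restrictₛₗ f (m i)) :=
  exteriorPower.alternatingMapLinearEquiv_apply_ιMulti _ _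

/-- The presheaf exterior power `U ↦ ⋀ᵏ P(U)`, as a functor. -/
def exteriorPower (k : ℕ) : PresheafOfModules.{u} (R ⋙ forget₂ CommRingCat RingCat) ⥤ PresheafOfModules.{u} (R ⋙ forget₂ CommRingCat RingCat) where
  obj P :=
  { obj U := ModuleCat.exteriorPower (R := R.obj U) (P.obj U) k
    map f := exteriorRes P k f
    map_id U := by
      apply ModuleCat.exteriorPower.hom_ext (R := R.obj U)
      apply AlternatingMap.ext
      intro m
      refine (exteriorRes_ιMulti P k (𝟙 U) m).trans ?_
      refine congrArg (exteriorPower.ιMulti (R.obj U) (M := P.obj U) k) (funext fun i => ?_)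
      change P.map (𝟙 U) (m i) = m i
      rw [P.map_id]; rfl
    map_comp {U V W} f g := by
      apply ModuleCat.exteriorPower.hom_ext (R := R.obj U)
      apply AlternatingMap.ext
      intro m
      refine (exteriorRes_ιMulti P k (f ≫ g) m).trans ?_
      refine Eq.trans ?_ (Eq.symm ((congrArg (exteriorRes P k g) (exteriorRes_ιMulti P k f m)).trans (exteriorRes_ιMulti P k g _)))
      refine congrArg (exteriorPower.ιMulti (R.obj W) (M := P.obj W) k) (funext fun i => ?_)
      exact P.map_comp_apply f g (m i) }
  map {P Q} φ := { app := fun U => ModuleCat.exteriorPower.map (R := R.obj U) (φ.app U) k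
                   naturality := by
                    intro U V f
                    apply ModuleCat.exteriorPower.hom_ext (R := R.obj U)
                    apply AlternatingMap.ext
                    intro m
                    refine (congrArg (ModuleCat.exteriorPower.map (R := R.obj V) (φ.app V) k) (exteriorRes_ιMulti P k f m)).trans ?_
                    refine (ModuleCat.exteriorPower.map_mk (R := R.obj V) (φ.app V) _).trans ?_
                    refine Eq.trans ?_ (Eq.symm ((congrArg (exteriorRes Q k f) (ModuleCat.exteriorPower.map_mk (R := R.obj U) (φ.app U) m)).trans (exteriorRes_ιMulti Q k f _)))
                    refine congrArg (exteriorPower.ιMulti (R.obj V) (M := Q.obj V) k) (funext fun i => ?_)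
                    exact naturality_apply φ f (m i) }
  map_id P := by
    ext1 U
    exact (ModuleCat.exteriorPower.functor (R.obj U) k).map_id (P.obj U)
  map_comp f g := by
    ext1 U
    exact (ModuleCat.exteriorPower.functor (R.obj U) k).map_comp (f.app U) (g.app U)
end PresheafOfModules

end ExteriorPower

section SheavesOfModules

namespace AlgebraicGeometry.Scheme.Modules

variable {X : Scheme.{u}}

instance : HasFiniteBiproducts X.Modules := Abelian.hasFiniteBiproducts

variable (X) in
/-- The sheaf of `𝒪_X`-modules associated with a presheaf of `𝒪_X`-modules. -/
def sheafify : X.PresheafOfModules ⥤ X.Modules :=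
  PresheafOfModules.sheafification (𝟙 X.ringCatSheaf.obj)

/-- The canonical morphism from a presheaf of modules to the associated sheaf. -/
def toSheafify (P : X.PresheafOfModules) :
    P ⟶ (toPresheafOfModules X).obj ((sheafify X).obj P) :=
  (PresheafOfModules.sheafificationAdjunction (𝟙 X.ringCatSheaf.obj)).unit.app P

/-- The `k`-th exterior power of sheaves of `𝒪_X`-modules: the sheaf associated with
`U ↦ ⋀ᵏ M(U)`, as a functor. -/
def exteriorPower (k : ℕ) : X.Modules ⥤ X.Modules :=
  toPresheafOfModules X ⋙ _root_.PresheafOfModules.exteriorPower (R := X.presheaf) k ⋙ sheafify X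

/-- The presheaf `U ↦ M(U) ⊗ N(U)`. -/
def presheafTensor (M N : X.Modules) : X.PresheafOfModules :=
  PresheafOfModules.Monoidal.tensorObj (R := X.presheaf) M.val N.val

/-- The tensor product `M ⊗ N` of sheaves of `𝒪_X`-modules. -/
def tensor (M N : X.Modules) : X.Modules := (sheafify X).obj (presheafTensor M N)

variable (X) in
/-- The structure sheaf as a sheaf of modules over itself. -/
abbrev structureSheaf : X.Modules := SheafOfModules.unit X.ringCatSheaf

/-- The morphism `M ≅ M ⊗ 𝒪_X ⟶ M ⊗ N` induced by a morphism `u : 𝒪_X ⟶ N`;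
on sections, `m ↦ m ⊗ u(1)`. -/
def toTensor (M : X.Modules) {N : X.Modules} (φ : structureSheaf X ⟶ N) : M ⟶ tensor M N :=
  ⟨(MonoidalCategory.rightUnitor
      (C := _root_.PresheafOfModules (X.presheaf ⋙ forget₂ CommRingCat RingCat)) M.val).inv ≫
    PresheafOfModules.Monoidal.tensorHom (R := X.presheaf) (𝟙 M.val) φ.val ≫
    toSheafify (presheafTensor M N)⟩

/-- For `j : Z ⟶ X` (a closed immersion, in the application), the sheaf
`M|_Z = M ⊗ j_* 𝒪_Z` on `X`. -/
def restrictTo {Z : Scheme.{u}} (j : Z ⟶ X) (M : X.Modules) : X.Modules :=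
  tensor M ((pushforward j).obj (structureSheaf Z))

/-- The canonical morphism `M ⟶ M|_Z`, obtained from `𝒪_X ⟶ j_* 𝒪_Z` by tensoring with `M`. -/
def toRestrictTo {Z : Scheme.{u}} (j : Z ⟶ X) (M : X.Modules) : M ⟶ restrictTo j M :=
  toTensor M (SheafOfModules.unitToPushforwardObjUnit j.toRingCatSheafHom)

/-- `M` is a vector bundle of rank `r`: every point has an open neighbourhood `U` on which
`M` is isomorphic to `𝒪_U ^ r`. -/
def IsVectorBundle (M : X.Modules) (r : ℕ) : Prop :=
  ∀ x : X, ∃ U : X.Opens, x ∈ U ∧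
    Nonempty (M.restrict U.ι ≅
      (SheafOfModules.free (R := U.toScheme.ringCatSheaf) (ULift.{u} (Fin r)) : U.toScheme.Modules))

/-- The cohomology group `Hⁱ(X, M)`. -/
abbrev cohomology (M : X.Modules) (i : ℕ) : Type u :=
  Sheaf.H.{u} ((SheafOfModules.toSheaf X.ringCatSheaf).obj M) i

end AlgebraicGeometry.Scheme.Modules

end SheavesOfModules

section Proj

namespace AlgebraicGeometry.Proj

variable {A : Type u} {σ : Type v} [CommRing A] [SetLike σ A] [AddSubgroupClass σ A]
variable (𝒜 : ℕ → σ) [GradedRing 𝒜]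

/-- The localization `A_𝔭` of `A` at the homogeneous prime `𝔭 = x`. -/
abbrev LocAt (x : ProjectiveSpectrum 𝒜) : Type u :=
  Localization x.asHomogeneousIdeal.toIdeal.primeCompl

variable {𝒜} in
/-- `s` is on all of `U` a fraction `r / t` of homogeneous elements with `deg r - deg t = a`. -/
def IsTwistedFraction (a : ℤ) {U : Opens (ProjectiveSpectrum 𝒜)} (s : ∀ x : U, LocAt 𝒜 x.1) :
    Prop :=
  ∃ i j : ℕ, (i : ℤ) = j + a ∧ ∃ r ∈ 𝒜 i, ∃ t ∈ 𝒜 j, ∃ h : ∀ x : U, t ∉ x.1.asHomogeneousIdeal,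
    ∀ x : U, s x = Localization.mk r ⟨t, h x⟩

/-- `s` is locally a fraction of homogeneous elements of degree `a`. -/
def twistedPredicate (a : ℤ) :
    TopCat.LocalPredicate (X := ProjectiveSpectrum.top 𝒜) (fun x => LocAt 𝒜 x) :=
  TopCat.PrelocalPredicate.sheafify
    { pred := fun {U} s => IsTwistedFraction (𝒜 := 𝒜) (U := U) a s
      res := by
        rintro V U f s ⟨i, j, e, r, hr, t, ht, h, hs⟩
        exact ⟨i, j, e, r, hr, t, ht, fun x => h (f x), fun x => hs (f x)⟩ }

variable {𝒜} in
/-- Pointwise multiplication by a section of the structure sheaf. -/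
def smulSection {U : (Proj 𝒜).Opens} (g : Γ(Proj 𝒜, U)) (s : ∀ x : U, LocAt 𝒜 x.1) : ∀ x : U, LocAt 𝒜 x.1 :=
  fun x => HomogeneousLocalization.val (g.1 x) * s x

lemma isTwisted_smul (a : ℤ) {U : (Proj 𝒜).Opens} (g : Γ(Proj 𝒜, U)) (s : ∀ x : U, LocAt 𝒜 x.1)
   (hs : (twistedPredicate 𝒜 a).pred s) : (twistedPredicate 𝒜 a).pred (smulSection g s) := by
  intro x
  obtain ⟨V, hV, ι, i, j, e, r, hr, t, ht, h, hs⟩ := hs x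
  obtain ⟨W, hW, κ, d, p, q, hq, hg⟩ := g.2 x
  refine ⟨V ⊓ W, ⟨hV, hW⟩, Opens.infLELeft _ _ ≫ ι, d + i, d + j, by push_cast; omega, p.1 * r, SetLike.mul_mem_graded p.2 hr,
    q.1 * t, SetLike.mul_mem_graded q.2 ht, fun y => y.1.asHomogeneousIdeal.toIdeal.primeCompl.mul_mem (hq ⟨y.1, y.2.2⟩) (h ⟨y.1, y.2.1⟩), fun y => ?_⟩
  have h1 := hs ⟨y.1, y.2.1⟩
  have h2 := congrArg HomogeneousLocalization.val (hg ⟨y.1, y.2.2⟩)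
  exact (congrArg₂ (· * ·) h2 h1).trans (Localization.mk_mul _ _ _ _)

lemma exists_large_degree (x : ProjectiveSpectrum 𝒜) (N : ℤ) :
    ∃ (j : ℕ) (t : A), t ∈ 𝒜 j ∧ t ∉ x.asHomogeneousIdeal ∧ N ≤ j := by
  classical
  obtain ⟨y, hy, hyx⟩ := SetLike.not_le_iff_exists.mp x.not_irrelevant_le
  obtain ⟨m, hm⟩ : ∃ m, (DirectSum.decompose 𝒜 y m : A) ∉ x.asHomogeneousIdeal.toIdeal := by
    by_contra! h
    apply hyx
    rw [← DirectSum.sum_support_decompose 𝒜 y]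
    exact Ideal.sum_mem _ fun i _ => h i
  have hm0 : m ≠ 0 := by
    rintro rfl
    apply hm
    have := (HomogeneousIdeal.mem_irrelevant_iff 𝒜 y).mp hy
    rw [GradedRing.proj_apply] at this
    rw [this]
    exact zero_mem _
  refine ⟨N.toNat * m, (DirectSum.decompose 𝒜 y m : A) ^ N.toNat, ?_, ?_, ?_⟩
  · simpa using SetLike.pow_mem_graded N.toNat (DirectSum.decompose 𝒜 y m).2
  · exact fun h => hm (x.isPrime.mem_of_pow_mem _ h)
  · have : N.toNat ≤ N.toNat * m := Nat.le_mul_of_pos_right _ (Nat.pos_of_ne_zero hm0)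
    omega

/-- The sections of `𝒪(a)` over `U`. -/
def twistedSections (a : ℤ) (U : (Proj 𝒜).Opens) : AddSubgroup (∀ x : U, LocAt 𝒜 x.1) where
  carrier := {s | (twistedPredicate 𝒜 a).pred s}
  zero_mem' := by
    intro x
    obtain ⟨j, t, ht, htx, hj⟩ := exists_large_degree 𝒜 x.1 (-a)
    refine ⟨U ⊓ ProjectiveSpectrum.basicOpen 𝒜 t, ⟨x.2, htx⟩, Opens.infLELeft _ _,
      (j + a).toNat, j, by omega, 0, zero_mem _, t, ht, fun y => y.2.2, fun y => ?_⟩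
    exact (Localization.mk_zero _).symm
  add_mem' := by
    intro s s' hs hs' x
    obtain ⟨V, hV, ι, i, j, e, r, hr, t, ht, h, hs⟩ := hs x
    obtain ⟨W, hW, κ, i', j', e', r', hr', t', ht', h', hs'⟩ := hs' x
    refine ⟨V ⊓ W, ⟨hV, hW⟩, Opens.infLELeft _ _ ≫ ι, j + i', j + j', by push_cast; omega,
      t * r' + t' * r, add_mem (SetLike.mul_mem_graded ht hr') ?_, t * t', SetLike.mul_mem_graded ht ht',
       fun y => y.1.asHomogeneousIdeal.toIdeal.primeCompl.mul_mem (h ⟨y.1, y.2.1⟩) (h' ⟨y.1, y.2.2⟩), fun y => ?_⟩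
    · rw [show j + i' = j' + i by omega]
      exact SetLike.mul_mem_graded ht' hr
    · exact (congrArg₂ (· + ·) (hs ⟨y.1, y.2.1⟩) (hs' ⟨y.1, y.2.2⟩)).trans (Localization.add_mk _ _ _ _)
  neg_mem' := by
    intro s hs x
    obtain ⟨V, hV, ι, i, j, e, r, hr, t, ht, h, hs⟩ := hs x
    exact ⟨V, hV, ι, i, j, e, -r, neg_mem hr, t, ht, h, fun y => (congrArg Neg.neg (hs y)).trans (Localization.neg_mk _ _)⟩

instance (a : ℤ) (U : (Proj 𝒜).Opens) : Module Γ(Proj 𝒜, U) (twistedSections 𝒜 a U) where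
  smul g s := ⟨smulSection g s.1, isTwisted_smul 𝒜 a g s.1 s.2⟩
  one_smul s := Subtype.ext <| funext fun x =>
    (congrArg (· * s.1 x) HomogeneousLocalization.val_one).trans (one_mul _)
  mul_smul g h s := Subtype.ext <| funext fun x =>
    (congrArg (· * s.1 x) (HomogeneousLocalization.val_mul (g.1 x) (h.1 x))).trans (mul_assoc _ _ _)
  smul_zero _ := Subtype.ext <| funext fun _ => mul_zero _
  smul_add _ _ _ := Subtype.ext <| funext fun _ => mul_add _ _ _
  add_smul g h s := Subtype.ext <| funext fun x =>
    (congrArg (· * s.1 x) (HomogeneousLocalization.val_add (g.1 x) (h.1 x))).trans (add_mul _ _ _)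
  zero_smul s := Subtype.ext <| funext fun x =>
    (congrArg (· * s.1 x) HomogeneousLocalization.val_zero).trans (zero_mul _)

/-- `𝒪(a)` as a presheaf of abelian groups. -/
def twistingAbPresheaf (a : ℤ) : TopCat.Presheaf AddCommGrpCat.{u} (Proj 𝒜) where
  obj U := AddCommGrpCat.of (twistedSections 𝒜 a U.unop)
  map {U V} f := AddCommGrpCat.ofHom
   { toFun := fun s => (⟨fun x => s.1 (f.unop x), (twistedPredicate 𝒜 a).res f.unop s.1 s.2⟩ : twistedSections 𝒜 a V.unop)
     map_zero' := rfl
     map_add' := fun _ _ => rfl }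

instance (a : ℤ) (U : (Proj 𝒜).Opensᵒᵖ) :
    Module ((Proj 𝒜).ringCatSheaf.obj.obj U) ((twistingAbPresheaf 𝒜 a).obj U) :=
  inferInstanceAs (Module Γ(Proj 𝒜, U.unop) (twistedSections 𝒜 a U.unop))

/-- Serre's twisting sheaf `𝒪(a)` on `Proj 𝒜`: its sections are the functions
`x ↦ s x ∈ A_x` that are locally fractions of homogeneous elements of degree `a`. -/
def twistingSheaf (a : ℤ) : (Proj 𝒜).Modules where
  val := PresheafOfModules.ofPresheaf (twistingAbPresheaf 𝒜 a) (fun _ _ _ _ _ => rfl)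
  isSheaf := by
    refine (TopCat.Presheaf.isSheaf_iff_isSheaf_comp (forget AddCommGrpCat) (twistingAbPresheaf 𝒜 a)).mpr ?_
    exact TopCat.Presheaf.isSheaf_of_iso (F := (TopCat.subsheafToTypes (twistedPredicate 𝒜 a)).1) (NatIso.ofComponents (fun _ => Iso.refl _) (fun _ => by ext; rfl))  (TopCat.subsheafToTypes (twistedPredicate 𝒜 a)).property

/-- The split bundle `⨁ⱼ 𝒪(aⱼ)`. -/
def splitBundle {m : ℕ} (a : Fin m → ℤ) : (Proj 𝒜).Modules :=
  ⨁ fun j => twistingSheaf 𝒜 (a j)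

/-- The sections `s` of the structure sheaf over `U` with `s x ∈ f A_x` for all `x ∈ U`. -/
def divisibleSections (f : A) (U : (Proj 𝒜).Opens) : Ideal Γ(Proj 𝒜, U) where
  carrier := {s | ∀ x : U, HomogeneousLocalization.val (s.1 x) ∈
    Ideal.span {algebraMap A (LocAt 𝒜 x.1) f}}
  zero_mem' x := by
    have h : HomogeneousLocalization.val ((0 : Γ(Proj 𝒜, U)).1 x) = 0 :=
      HomogeneousLocalization.val_zero
    rw [h]
    exact zero_mem _
  add_mem' {s t} hs ht x := by
    have h : HomogeneousLocalization.val ((s + t).1 x) =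
        HomogeneousLocalization.val (s.1 x) + HomogeneousLocalization.val (t.1 x) :=
      HomogeneousLocalization.val_add _ _
    rw [h]
    exact add_mem (hs x) (ht x)
  smul_mem' s t ht x := by
    have h : HomogeneousLocalization.val ((s • t).1 x) =
        HomogeneousLocalization.val (s.1 x) * HomogeneousLocalization.val (t.1 x) :=
      HomogeneousLocalization.val_mul _ _
    rw [h]
    exact Ideal.mul_mem_left _ _ (ht x)

/-- The ideal sheaf of `V(f)`, for `f` homogeneous. -/
def hypersurfaceIdeal (f : A) : (Proj 𝒜).IdealSheafData :=
  Scheme.IdealSheafData.ofIdeals fun U => divisibleSections 𝒜 f U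

/-- The closed subscheme `V(f)` of `Proj 𝒜`, for `f` homogeneous. -/
def hypersurface (f : A) : Scheme.{u} := (hypersurfaceIdeal 𝒜 f).subscheme

/-- The inclusion of `V(f)` into `Proj 𝒜`. -/
def hypersurfaceι (f : A) : hypersurface 𝒜 f ⟶ Proj 𝒜 := (hypersurfaceIdeal 𝒜 f).subschemeι

/-- A finite minimal free resolution `0 ⟶ F_t ⟶ ⋯ ⟶ F_1 ⟶ F_0 ⟶ G ⟶ 0` of `G` by direct sums
`F_i = ⨁ⱼ 𝒪(deg i j)` of line bundles. -/
structure MinimalFreeResolution (G : (Proj 𝒜).Modules) where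
  rank : ℕ → ℕ
  deg (i : ℕ) : Fin (rank i) → ℤ
  d (i : ℕ) : splitBundle 𝒜 (deg (i + 1)) ⟶ splitBundle 𝒜 (deg i)
  aug : splitBundle 𝒜 (deg 0) ⟶ G
  d_comp_d (i : ℕ) : d (i + 1) ≫ d i = 0
  d_comp_aug : d 0 ≫ aug = 0
  exact (i : ℕ) : (ShortComplex.mk (d (i + 1)) (d i) (d_comp_d i)).Exact
  exact_aug : (ShortComplex.mk (d 0) aug d_comp_aug).Exact
  epi_aug : Epi aug
  finite_length : ∃ t : ℕ, ∀ i, t < i → rank i = 0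
  /-- minimality: no entry of the matrix of a differential is a nonzero constant -/
  minimal (i : ℕ) (j : Fin (rank (i + 1))) (l : Fin (rank i)) : deg (i + 1) j = deg i l →
    biproduct.ι (fun j => twistingSheaf 𝒜 (deg (i + 1) j)) j ≫ d i ≫
      biproduct.π (fun l => twistingSheaf 𝒜 (deg i l)) l = 0

variable {𝒜}

/-- `E(l) = E ⊗ 𝒪_X(l)` on `X = V(f)`, where `𝒪_X(l)` is the pullback of `𝒪(l)`. -/
def hypersurfaceTwist {f : A} (E : (hypersurface 𝒜 f).Modules) (l : ℤ) :
    (hypersurface 𝒜 f).Modules :=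
  Scheme.Modules.tensor E ((Scheme.Modules.pullback (hypersurfaceι 𝒜 f)).obj (twistingSheaf 𝒜 l))

/-- `E` is arithmetically Cohen-Macaulay on `X = V(f)` of dimension `n`:
`Hⁱ(X, E(l)) = 0` for all `l` and all `0 < i < n`. -/
def IsACM {f : A} (n : ℕ) (E : (hypersurface 𝒜 f).Modules) : Prop :=
  ∀ (l : ℤ) (i : ℕ), 0 < i → i < n →
    Subsingleton (Scheme.Modules.cohomology (hypersurfaceTwist E l) i)

/-- `E^σ`, the kernel of the restriction `F_0|_X ⟶ E` to `X = V(f)` of the augmentation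
`F_0 ⟶ i_* E` of a minimal free resolution. -/
def sigma {f : A} {E : (hypersurface 𝒜 f).Modules}
    (F : MinimalFreeResolution 𝒜 ((Scheme.Modules.pushforward (hypersurfaceι 𝒜 f)).obj E)) :
    (hypersurface 𝒜 f).Modules :=
  kernel (((Scheme.Modules.pullbackPushforwardAdjunction (hypersurfaceι 𝒜 f)).homEquiv _ _).symm
    F.aug)

/-- The cokernel `𝓕_k` of `⋀ᵏ φ : ⋀ᵏ F_1 ⟶ ⋀ᵏ F_0`, where `φ : F_1 ⟶ F_0` is the first
differential of a minimal free resolution. -/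
def wedgeCokernel {G : (Proj 𝒜).Modules} (F : MinimalFreeResolution 𝒜 G) (k : ℕ) :
    (Proj 𝒜).Modules :=
  cokernel ((Scheme.Modules.exteriorPower k).map (F.d 0))

end AlgebraicGeometry.Proj

end Proj

section ProjectiveSpace

namespace AlgebraicGeometry

/-- The standard grading of `K[x_0, …, x_N]` is a grading of algebras. -/
instance standardGradedAlgebra (K : Type u) [Field K] (N : ℕ) :
    GradedAlgebra (MvPolynomial.homogeneousSubmodule (Fin (N + 1)) K) :=
  MvPolynomial.gradedAlgebra

/-- Projective space `ℙᴺ` over `K`. -/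
abbrev projectiveSpace (K : Type u) [Field K] (N : ℕ) : Scheme.{u} :=
  Proj (MvPolynomial.homogeneousSubmodule (Fin (N + 1)) K)

/-- The structure morphism `ℙᴺ ⟶ Spec K`. -/
def projectiveSpaceToSpec (K : Type u) [Field K] (N : ℕ) :
    projectiveSpace K N ⟶ Spec (CommRingCat.of K) :=
  Proj.toSpecZero _ ≫ Spec.map (CommRingCat.ofHom
    (algebraMap K (MvPolynomial.homogeneousSubmodule (Fin (N + 1)) K 0)))

end AlgebraicGeometry

end ProjectiveSpace

end

/-! Write `L = 𝒪(-(k-1)d)`. Two morphisms leave `⋀ᵏ F₀ ⊗ L`: the epimorphism `q` onto `⋀ᵏ E ⊗ L`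
induced by `F₀ ⟶ i_* E`, and the map `m` to `𝓕_k` which multiplies by `f ^ (k-1)` and takes the
class modulo the image of `⋀ᵏ φ`. The image of `m` is `f ^ (k-1) 𝓕_k`, which is exactly the kernel
of `𝓕_k ⟶ 𝓕_k|_{X_{k-1}}`. So everything reduces to `Ker q = Ker m`: then `m` factors through `q` as
a monomorphism with the required image (`exists_shortExact`).

Equality of the kernels is a local statement in commutative algebra,
`exteriorPower.eq_zero_iff_pow_smul_mem_range`. Let `a` be a nonzerodivisor of `R`, `S = R/a`, and
let `F₁ ⟶ F₀ ⟶ E ⟶ 0` be exact with `F₀` projective over `R` and `E` free over `S`. Then `w ∈ ⋀ᵏ F₀`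
dies in `⋀ᵏ E` iff `a ^ (k-1) w` lies in the image of `⋀ᵏ φ`. In one direction, coordinates of `E`
lift to functionals on `F₀` which are divisible by `a` on `φ(F₁)`; their `k × k` minors are
divisible by `a ^ k` on the image of `⋀ᵏ φ`, and `a ^ (k-1)` cancels. In the other, `F₀` is spanned
by lifts of a basis of `E` and by `φ(F₁)`, while `a F₀ ⊆ φ(F₁)`: a wedge with one factor in `φ(F₁)`
needs only `k-1` further factors `a`, and a combination of wedges of lifts which dies in `⋀ᵏ E` is
itself divisible by `a`.

To apply this on `Proj`, `exists_presentation_nhd` makes the presentation exact on sections over all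
small affine opens, `mem_hypersurfaceIdeal_iff` shows that `f / ℓ ^ d` generates the ideal of `V(f)`
on affine opens where the linear form `ℓ` does not vanish, and `exists_wedge_shortExact` passes from
such charts to sheaves. -/

noncomputable section

/-! ### Exterior powers of a presentation modulo a nonzerodivisor -/

section

open exteriorPower

/-- By multilinearity the `k` factors `a` can be distributed, one to each vector of a wedge. -/
theorem exteriorPower.pow_smul_mem_range_map {R M N : Type*} [CommRing R] [AddCommGroup M]
    [Module R M] [AddCommGroup N] [Module R N] (φ : M →ₗ[R] N) (a : R)
    (h : ∀ y, a • y ∈ LinearMap.range φ) (k : ℕ) (w : ⋀[R]^k N) :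
    a ^ k • w ∈ LinearMap.range (exteriorPower.map k φ) := by
  have hw : w ∈ Submodule.span R (Set.range (ιMulti R k (M := N))) := by
    rw [ιMulti_span]; trivial
  induction hw using Submodule.span_induction with
  | mem w hw =>
    obtain ⟨m, rfl⟩ := hw
    choose g hg using fun i => h (m i)
    refine ⟨ιMulti R k g, ?_⟩
    rw [map_apply_ιMulti, show φ ∘ g = fun i => a • m i from funext hg]
    exact ((ιMulti R k).map_smul_univ (fun _ => a) m).trans (by simp)
  | zero => simp
  | add x y _ _ hx hy => rw [smul_add]; exact add_mem hx hy
  | smul r x _ hx => rw [smul_comm]; exact Submodule.smul_mem _ _ hx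

/-- A factor already in the range needs no multiplication by `a`; this saving is the source of the
exponent `k - 1`. -/
theorem exteriorPower.pow_smul_ιMulti_mem_range_map {R M N : Type*} [CommRing R] [AddCommGroup M]
    [Module R M] [AddCommGroup N] [Module R N] (φ : M →ₗ[R] N) (a : R)
    (h : ∀ y, a • y ∈ LinearMap.range φ) (k : ℕ) (m : Fin k → N) (i : Fin k)
    (hi : m i ∈ LinearMap.range φ) :
    a ^ (k - 1) • ιMulti R k m ∈ LinearMap.range (exteriorPower.map k φ) := by
  classical
  have hg : ∀ j, ∃ g, φ g = (if j = i then 1 else a) • m j := by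
    intro j
    by_cases hj : j = i
    · subst hj; simpa using hi
    · simpa [hj] using h (m j)
  choose g hg using hg
  refine ⟨ιMulti R k g, ?_⟩
  rw [map_apply_ιMulti, show φ ∘ g = fun j => (if j = i then 1 else a) • m j from funext hg]
  refine ((ιMulti R k).map_smul_univ (fun j => if j = i then 1 else a) m).trans ?_
  congr 1
  rw [Finset.prod_ite]
  simp [Finset.filter_ne']

section
variable {R S F₁ F₀ E : Type*} [CommRing R] [CommRing S] [AddCommGroup F₁] [Module R F₁]
  [AddCommGroup F₀] [Module R F₀] [AddCommGroup E] [Module S E]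

/-- On a wedge the pairing is a `k × k` determinant, here with every entry divisible by `a`. -/
theorem exteriorPower.pow_dvd_pairingDual_map {a : R} (φ : F₁ →ₗ[R] F₀) {k : ℕ}
    (μ : Fin k → Module.Dual R F₀) (h : ∀ i g, a ∣ μ i (φ g)) (v : ⋀[R]^k F₁) :
    a ^ k ∣ pairingDual R F₀ k (ιMulti R k μ) (exteriorPower.map k φ v) := by
  have hv : v ∈ Submodule.span R (Set.range (ιMulti R k (M := F₁))) := by
    rw [ιMulti_span]; trivial
  induction hv using Submodule.span_induction with
  | mem w hw =>
    obtain ⟨m, rfl⟩ := hw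
    choose c hc using fun i j => h i (m j)
    rw [map_apply_ιMulti, pairingDual_ιMulti_ιMulti]
    refine ⟨(Matrix.of fun i j => c j i).det, ?_⟩
    have : (Matrix.of fun i j => μ j ((φ ∘ m) i)) = a • (Matrix.of fun i j => c j i) := by
      ext i j; simp [hc]
    rw [this, Matrix.det_smul, Fintype.card_fin]
  | zero => simp
  | add x y _ _ hx hy => simp only [map_add]; exact dvd_add hx hy
  | smul r x _ hx => simp only [map_smul, smul_eq_mul]; exact hx.mul_left _

/-- The algebraic core: it identifies the kernel of `⋀ᵏ F₀ → ⋀ᵏ E` with the kernel of multiplication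
by `a ^ (k-1)` into the cokernel of `⋀ᵏ φ`. -/
theorem exteriorPower.eq_zero_iff_pow_smul_mem_range (π : R →+* S) (hπ : Function.Surjective π)
    (a : R) (hker : ∀ x, π x = 0 ↔ a ∣ x) (ha : a ∈ nonZeroDivisors R)
    (φ : F₁ →ₗ[R] F₀) (ε : F₀ →ₛₗ[π] E) (hex : ∀ y, ε y = 0 ↔ ∃ g, φ g = y)
    (hε : Function.Surjective ε) [Module.Projective R F₀] {r : ℕ} (b : Module.Basis (Fin r) S E)
    {k : ℕ} (hk : 1 ≤ k) (W : ⋀[R]^k F₀ →ₛₗ[π] ⋀[S]^k E)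
    (hW : ∀ m, W (ιMulti R k m) = ιMulti S k (fun i => ε (m i))) (w : ⋀[R]^k F₀) :
    W w = 0 ↔ a ^ (k - 1) • w ∈ LinearMap.range (exteriorPower.map k φ) := by
  have hkill : ∀ y, a • y ∈ LinearMap.range φ := fun y =>
    (hex _).1 (by rw [map_smulₛₗ, (hker a).2 dvd_rfl, zero_smul])
  have mpr : ∀ w, a ^ (k - 1) • w ∈ LinearMap.range (exteriorPower.map k φ) → W w = 0 := by
    intro w hw
    let _ : Algebra R S := π.toAlgebra
    -- Projectivity of `F₀` lifts each coordinate of `ε` through the surjection `π`.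
    have hμ : ∀ i, ∃ μ : F₀ →ₗ[R] R, ∀ y, π (μ y) = b.coord i (ε y) := by
      intro i
      obtain ⟨μ, hμ⟩ := Module.projective_lifting_property (Algebra.linearMap R S)
        ({ toFun := fun y => b.coord i (ε y)
           map_add' := by simp
           map_smul' := fun r y => by
            rw [map_smulₛₗ, map_smul, Algebra.smul_def]; rfl } : F₀ →ₗ[R] S) hπ
      exact ⟨μ, fun y => congr($hμ y)⟩
    choose μ hμ using hμ
    refine (b.exteriorPower (n := k)).ext_elem fun s => ?_
    rw [basis_repr_apply, basis_repr_apply, map_zero]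
    -- The minors of the lifted functionals reduce modulo `a` to the coordinates of `W w` in the
    -- exterior basis.
    have key : ∀ w, π (pairingDual R F₀ k (ιMulti_family R k μ s) w) = ιMultiDual S k b s (W w) :=
      by
      intro w
      have hw : w ∈ Submodule.span R (Set.range (ιMulti R k (M := F₀))) := by
        rw [ιMulti_span]; trivial
      induction hw using Submodule.span_induction with
      | mem w hw =>
        obtain ⟨m, rfl⟩ := hw
        rw [hW, ιMultiDual_apply_ιMulti, ιMulti_family, pairingDual_ιMulti_ιMulti, RingHom.map_det]
        congr 1
        ext i j
        simp [hμ]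
      | zero => simp
      | add x y _ _ hx hy => simp only [map_add, hx, hy]
      | smul r x _ hx => simp only [map_smul, map_smulₛₗ, smul_eq_mul, map_mul, hx]
    rw [← key, hker]
    obtain ⟨v, hv⟩ := hw
    -- Each `μ i` is divisible by `a` on the range of `φ`, since `ε ∘ φ = 0`; cancelling `a ^ (k-1)`
    -- then leaves one factor `a`.
    have h1 : a ^ k ∣ a ^ (k - 1) * pairingDual R F₀ k (ιMulti_family R k μ s) w := by
      rw [← smul_eq_mul, ← map_smul, ← hv]
      refine pow_dvd_pairingDual_map φ _ (fun i g => ?_) v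
      rw [Function.comp_apply, ← hker, hμ, (hex _).2 ⟨g, rfl⟩, map_zero]
    obtain ⟨c, hc⟩ := h1
    refine ⟨c, ?_⟩
    rw [← mul_cancel_left_mem_nonZeroDivisors (pow_mem ha (k - 1)), hc, ← mul_assoc, ← pow_succ,
      Nat.sub_add_cancel hk]
  refine ⟨fun hw => ?_, mpr w⟩
  choose e he using fun i => hε (b i)
  let L : (Fin r → R) →ₗ[R] F₀ := Fintype.linearCombination R e
  have hLe : ∀ i, L (Pi.basisFun R (Fin r) i) = e i := fun i => by
    simp [L, Fintype.linearCombination_apply_single]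
  -- The submodule of all `w` for which the desired conclusion holds.
  let N := (LinearMap.range (exteriorPower.map k φ)).comap
    (LinearMap.lsmul R _ (a ^ (k - 1)))
  have hspan : Submodule.span R (Set.range e ∪ Set.range φ) = ⊤ := by
    refine eq_top_iff.2 fun y _ => ?_
    choose c hc using fun i => hπ (b.repr (ε y) i)
    have : ε (y - ∑ i, c i • e i) = 0 := by
      rw [map_sub, map_sum, sub_eq_zero]
      conv_lhs => rw [← b.sum_repr (ε y)]
      simp [map_smulₛₗ, hc, he]
    obtain ⟨g, hg⟩ := (hex _).1 this
    rw [← sub_add_cancel y (∑ i, c i • e i), ← hg]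
    refine add_mem (Submodule.subset_span (Or.inr ⟨g, rfl⟩)) (sum_mem fun i _ =>
      Submodule.smul_mem _ _ (Submodule.subset_span (Or.inl ⟨i, rfl⟩)))
  -- A wedge of generators either has a factor in the range of `φ`, hence lies in `N`, or involves
  -- only the lifts `e i`.
  have htop : LinearMap.range (exteriorPower.map k L) ⊔ N = ⊤ := by
    rw [eq_top_iff, ← ιMulti_span_of_span R k F₀ hspan, Submodule.span_le]
    rintro _ ⟨m, hm, rfl⟩
    by_cases h : ∃ i, m i ∈ Set.range φ
    · obtain ⟨i, hi⟩ := h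
      exact Submodule.mem_sup_right (pow_smul_ιMulti_mem_range_map φ a hkill k m i hi)
    · push Not at h
      choose c hc using fun i => (hm ⟨i, rfl⟩ : m i ∈ Set.range e ∪ Set.range φ).resolve_right (h i)
      refine Submodule.mem_sup_left ⟨ιMulti R k (fun i => Pi.basisFun R (Fin r) (c i)), ?_⟩
      rw [map_apply_ιMulti]
      congr 1
      ext i
      simp only [Function.comp_apply, hLe, hc]
  obtain ⟨_, ⟨x, rfl⟩, n, hn, hx⟩ := Submodule.mem_sup.1 (htop ▸ Submodule.mem_top : w ∈ _)
  rw [← hx, smul_add]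
  refine add_mem ?_ hn
  have hWx : W (exteriorPower.map k L x) = 0 := by
    rw [← hx, map_add, mpr n hn, add_zero] at hw
    exact hw
  let B := (Pi.basisFun R (Fin r)).exteriorPower (n := k)
  -- The part built from the lifts also dies in `⋀ᵏ E`, where the wedges of the basis are
  -- independent. So its coefficients vanish in `S`, and the extra factor `a` raises `a ^ (k-1)` to
  -- `a ^ k`.
  have hx0 : ∀ s, a ∣ B.repr x s := by
    have : ∑ s, π (B.repr x s) • b.exteriorPower (n := k) s = 0 := by
      rw [← hWx]
      conv_rhs => rw [← B.sum_repr x]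
      simp only [map_sum, map_smulₛₗ]
      refine Finset.sum_congr rfl fun s _ => ?_
      congr 1
      rw [basis_apply, basis_apply, map_apply_ιMulti_family, ιMulti_family, ιMulti_family, hW]
      congr 1
      ext i
      exact ((congrArg ε (hLe _)).trans (he _)).symm
    intro s
    rw [← hker]
    exact Fintype.linearIndependent_iff.1 (b.exteriorPower (n := k)).linearIndependent _ this s
  choose c hc using hx0
  have : x = a • ∑ s, c s • B s := by
    conv_lhs => rw [← B.sum_repr x]
    simp [Finset.smul_sum, hc, mul_smul]
  rw [this, map_smul, smul_smul, ← pow_succ, Nat.sub_add_cancel hk]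
  exact pow_smul_mem_range_map φ a hkill k _
end

end

/-! ### Sections of sheaves of modules; local criteria for exactness -/

namespace AlgebraicGeometry.Scheme

variable {X : Scheme.{u}}

/-- The sections over `U` of a presheaf of `𝒪_X`-modules. -/
def Sec (P : X.PresheafOfModules) (U : X.Opens) : Type u := P.obj (op U)

namespace Sec

variable {P Q T : X.PresheafOfModules} {U V W : X.Opens}

instance : AddCommGroup (Sec P U) := inferInstanceAs (AddCommGroup (P.obj (op U)))

instance : Module Γ(X, U) (Sec P U) := (P.obj (op U)).isModule

/-- The restriction map of the structure sheaf. -/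
abbrev ringRes (h : V ≤ U) : Γ(X, U) →+* Γ(X, V) := (X.presheaf.map (homOfLE h).op).hom

/-- The restriction map of a presheaf of modules. -/
def res (h : V ≤ U) : Sec P U →ₛₗ[ringRes h] Sec P V where
  toFun s := P.map (homOfLE h).op s
  map_add' s t := map_add (P.map (homOfLE h).op).hom s t
  map_smul' r s := P.map_smul (homOfLE h).op r s

/-- The action on sections of a morphism of presheaves of modules. -/
def app (φ : P ⟶ Q) (U : X.Opens) : Sec P U →ₗ[Γ(X, U)] Sec Q U where
  toFun s := φ.app (op U) s
  map_add' s t := map_add (φ.app (op U)).hom s t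
  map_smul' r s := (φ.app (op U)).hom.map_smul r s

lemma res_app (φ : P ⟶ Q) (h : V ≤ U) (s : Sec P U) : res h (app φ U s) = app φ V (res h s) :=
  (PresheafOfModules.naturality_apply φ (homOfLE h).op s).symm

lemma res_res (h : V ≤ U) (h' : W ≤ V) (s : Sec P U) : res h' (res h s) = res (h'.trans h) s :=
  (P.map_comp_apply (homOfLE h).op (homOfLE h').op s).symm

@[simp] lemma app_comp (φ : P ⟶ Q) (ψ : Q ⟶ T) (s : Sec P U) :
    app (φ ≫ ψ) U s = app ψ U (app φ U s) := rfl

@[simp] lemma app_zero (s : Sec P U) : app (0 : P ⟶ Q) U s = 0 := rfl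

lemma ext_hom {φ ψ : P ⟶ Q} (h : ∀ U (s : Sec P U), app φ U s = app ψ U s) : φ = ψ := by
  apply PresheafOfModules.hom_ext
  intro U
  exact ModuleCat.hom_ext (LinearMap.ext fun s => h U.unop s)

end Sec

namespace Modules

variable {M N T : X.Modules} {U V : X.Opens}

open Sec

/-- The underlying presheaf of modules. -/
abbrev pre (M : X.Modules) : X.PresheafOfModules := (toPresheafOfModules X).obj M

/-- The underlying morphism of presheaves of modules. -/
abbrev preHom (φ : M ⟶ N) : pre M ⟶ pre N := (toPresheafOfModules X).map φ

/-- The morphism of sheaves of modules given by a morphism of presheaves of modules. -/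
abbrev ofPre (φ : pre M ⟶ pre N) : M ⟶ N := ⟨φ⟩

lemma sec_eq_of_locally_eq (s t : Sec (pre M) U)
    (h : ∀ x ∈ U, ∃ (V : X.Opens) (hV : V ≤ U), x ∈ V ∧ res hV s = res hV t) : s = t := by
  choose! V hV hx h using h
  refine TopCat.Sheaf.eq_of_locally_eq' (F := ⟨M.presheaf, M.isSheaf⟩) (fun x : U => V x.1) U
    (fun x => homOfLE (hV x.1 x.2)) ?_ s t fun x => h x.1 x.2
  intro x hxU
  simp only [Opens.mem_iSup]
  exact ⟨⟨x, hxU⟩, hx x hxU⟩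

lemma toSheafify_res_eq (P : X.PresheafOfModules) (s : Sec P U)
   (h : app (toSheafify P) U s = 0) {x : X} (hx : x ∈ U) :
    ∃ (V : X.Opens) (hV : V ≤ U), x ∈ V ∧ res hV s = 0 := by
  have := Presheaf.equalizerSieve_mem (Opens.grothendieckTopology X)
    (CategoryTheory.toSheafify (Opens.grothendieckTopology X) P.presheaf) (X := op U) s 0
    (by rw [map_zero]; exact h)
  obtain ⟨V, f, hf, hxV⟩ := this x hx
  refine ⟨V, leOfHom f, hxV, ?_⟩
  exact hf.trans (map_zero (P.presheaf.map f.op).hom)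

lemma toSheafify_lift (P : X.PresheafOfModules) (s : Sec (pre ((sheafify X).obj P)) U)
   {x : X} (hx : x ∈ U) :
    ∃ (V : X.Opens) (hV : V ≤ U) (t : Sec P V), x ∈ V ∧ app (toSheafify P) V t = res hV s := by
  have := Presheaf.imageSieve_mem (Opens.grothendieckTopology X)
    (CategoryTheory.toSheafify (Opens.grothendieckTopology X) P.presheaf) (U := op U) s
  obtain ⟨V, f, ⟨t, hf⟩, hxV⟩ := this x hx
  exact ⟨V, leOfHom f, t, hxV, hf⟩

/-- The map from `N` to the sheafified presheaf cokernel of `g` kills `g`, hence is zero. So the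
class of `s` in the presheaf cokernel vanishes locally, and that cokernel is computed section by
section. -/
lemma exists_app_eq_of_epi (g : M ⟶ N) [Epi g] (s : Sec (pre N) U) {x : X} (hx : x ∈ U) :
    ∃ (V : X.Opens) (hV : V ≤ U) (t : Sec (pre M) V), x ∈ V ∧ app (preHom g) V t = res hV s := by
  let p := cokernel.π ((toPresheafOfModules X).map g)
  have h0 : g ≫ (ofPre (p ≫ toSheafify _) : N ⟶ (sheafify X).obj _) = 0 := by
    apply SheafOfModules.hom_ext
    change preHom g ≫ p ≫ toSheafify _ = 0
    rw [← Category.assoc, cokernel.condition ((toPresheafOfModules X).map g), zero_comp]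
  have h1 : (ofPre (p ≫ toSheafify _) : N ⟶ (sheafify X).obj _) = 0 := (cancel_epi g).1
    (h0.trans comp_zero.symm)
  have h2 : app (toSheafify _) U (app p U s) = 0 := by
    have := congrArg (fun q : N ⟶ (sheafify X).obj _ => app (preHom q) U s) h1
    exact this
  obtain ⟨V, hV, hxV, h⟩ := toSheafify_res_eq _ _ h2 hx
  rw [res_app] at h
  have hex := ((ShortComplex.exact_cokernel ((toPresheafOfModules X).map
    g)).map_of_epi_of_preservesCokernel
    (PresheafOfModules.evaluation _ (op V)) inferInstance inferInstance)
  obtain ⟨t, ht⟩ := (ShortComplex.moduleCat_exact_iff _).1 hex (res hV s) h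
  exact ⟨V, hV, t, hxV, ht⟩

lemma ext_sec {φ ψ : M ⟶ N} (h : ∀ U (s : Sec (pre M) U), app (preHom φ) U s = app (preHom ψ) U s) :
    φ = ψ :=
  (toPresheafOfModules X).map_injective (Sec.ext_hom h)

@[simp] lemma preHom_zero : preHom (0 : M ⟶ N) = 0 := rfl

lemma preHom_comp (φ : M ⟶ N) (ψ : N ⟶ T) : preHom (φ ≫ ψ) = preHom φ ≫ preHom ψ := rfl

variable (X) in
/-- The functor of sections over `U`. -/
abbrev secFunctor (U : X.Opens) : X.Modules ⥤ ModuleCat (X.ringCatSheaf.obj.obj (op U)) :=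
  toPresheafOfModules X ⋙ PresheafOfModules.evaluation _ (op U)

lemma app_injective_of_mono (g : M ⟶ N) [Mono g] : Function.Injective (app (preHom g) U) := by
  have : Mono (preHom g) := inferInstance
  exact PresheafOfModules.injective_of_mono (preHom g) (op U)

/-- Kernels are computed on sections, and exactness makes the map from `S.X₁` to the kernel of `S.g`
an epimorphism, so local lifting for epimorphisms applies. -/
lemma exists_app_eq_of_exact (S : ShortComplex X.Modules) (hS : S.Exact) (s : Sec (pre S.X₂) U)
    (hs : app (preHom S.g) U s = 0) {x : X} (hx : x ∈ U) :
    ∃ (V : X.Opens) (hV : V ≤ U) (t : Sec (pre S.X₁) V), x ∈ V ∧ app (preHom S.f) V t = res hV s :=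
      by
  have : Epi (kernel.lift S.g S.f S.zero) := S.exact_iff_epi_kernel_lift.1 hS
  have : (secFunctor X U).PreservesZeroMorphisms := ⟨fun M N => rfl⟩
  have hex := (ShortComplex.exact_kernel S.g).map_of_mono_of_preservesKernel (secFunctor X U)
    inferInstance inferInstance
  obtain ⟨(s' : Sec (pre (kernel S.g)) U), (hs' : app (preHom (kernel.ι S.g)) U s' = s)⟩ :=
    (ShortComplex.moduleCat_exact_iff _).1 hex s hs
  obtain ⟨V, hV, t, hxV, ht⟩ := exists_app_eq_of_epi (kernel.lift S.g S.f S.zero) (U := U) s' hx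
  refine ⟨V, hV, t, hxV, ?_⟩
  have h1 : app (preHom S.f) V t = app (preHom (kernel.ι S.g)) V (app (preHom
    (kernel.lift S.g S.f S.zero)) V t) := by
    conv_lhs => rw [← kernel.lift_ι S.g S.f S.zero]
    rfl
  rw [h1, ht, ← res_app, hs']

lemma epi_of_locally (g : M ⟶ N) (h : ∀ (U : X.Opens) (s : Sec (pre N) U), ∀ x ∈ U,
    ∃ (V : X.Opens) (hV : V ≤ U) (t : Sec (pre M) V), x ∈ V ∧ app (preHom g) V t = res hV s) :
    Epi g := by
  refine Preadditive.epi_of_cancel_zero _ fun {Z} q hq => ext_sec fun U s => ?_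
  refine sec_eq_of_locally_eq _ _ fun x hx => ?_
  obtain ⟨V, hV, t, hxV, ht⟩ := h U s x hx
  refine ⟨V, hV, hxV, ?_⟩
  rw [res_app, ← ht, ← app_comp, ← preHom_comp, hq]
  simp

lemma exact_of_locally (S : ShortComplex X.Modules)
   (h : ∀ (U : X.Opens) (s : Sec (pre S.X₂) U), app (preHom S.g) U s = 0 → ∀ x ∈ U,
    ∃ (V : X.Opens) (hV : V ≤ U) (t : Sec (pre S.X₁) V), x ∈ V ∧ app (preHom S.f) V t = res hV s) :
    S.Exact := by
  rw [S.exact_iff_epi_kernel_lift]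
  refine epi_of_locally _ fun U s x hx => ?_
  obtain ⟨V, hV, t, hxV, ht⟩ := h U (app (preHom (kernel.ι S.g)) U s)
    (congrArg (fun q : _ ⟶ S.X₃ => app (preHom q) U s) (kernel.condition S.g)) x hx
  refine ⟨V, hV, t, hxV, ?_⟩
  rw [res_app] at ht
  apply app_injective_of_mono (kernel.ι S.g)
  rw [← ht, ← app_comp, ← preHom_comp, kernel.lift_ι]
/-- An epimorphism `q` and a morphism `m` with the same kernel, where `m` is exact at the source of
an epimorphism `ρ`, give a short exact sequence. -/
lemma exists_shortExact {B C D Q : X.Modules} (q : B ⟶ C) [Epi q] (m : B ⟶ D) (ρ : D ⟶ Q)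
    (hqm : ∀ U (z : Sec (pre B) U), app (preHom q) U z = 0 ↔ app (preHom m) U z = 0)
    (hmρ : ∀ U (z : Sec (pre B) U), app (preHom ρ) U (app (preHom m) U z) = 0)
    (hex : ∀ (U : X.Opens) (s : Sec (pre D) U), app (preHom ρ) U s = 0 → ∀ x ∈ U,
      ∃ (V : X.Opens) (hV : V ≤ U) (t : Sec (pre B) V), x ∈ V ∧ app (preHom m) V t = res hV s)
    (hρ : ∀ (U : X.Opens) (s : Sec (pre Q) U), ∀ x ∈ U,
      ∃ (V : X.Opens) (hV : V ≤ U) (t : Sec (pre D) V), x ∈ V ∧ app (preHom ρ) V t = res hV s) :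
    ∃ (ι : C ⟶ D) (w : ι ≫ ρ = 0), (ShortComplex.mk ι ρ w).ShortExact := by
  have hker : kernel.ι q ≫ m = 0 := ext_sec fun U s => by
    rw [preHom_comp, app_comp, preHom_zero, app_zero, ← hqm, ← app_comp, ← preHom_comp,
      kernel.condition, preHom_zero, app_zero]
  have hι : q ≫ Abelian.epiDesc q m hker = m := Abelian.comp_epiDesc _ _ _
  generalize Abelian.epiDesc q m hker = ι at hι
  have hιq : ∀ U (z : Sec (pre B) U), app (preHom ι) U (app (preHom q) U z) = app (preHom m) U z :=
    fun U z => by rw [← app_comp, ← preHom_comp, hι]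
  have w : ι ≫ ρ = 0 := by
    rw [← cancel_epi q, comp_zero, ← Category.assoc, hι]
    exact ext_sec hmρ
  -- A section killed by `ι` lifts locally along `q` to some `t`; then `m` kills `t`, hence so does
  -- `q`.
  have : Mono ι := by
    refine Preadditive.mono_of_cancel_zero _ fun {Z} g hg => ext_sec fun U s => ?_
    refine sec_eq_of_locally_eq _ _ fun x hx => ?_
    obtain ⟨V, hV, t, hxV, ht⟩ := exists_app_eq_of_epi q (app (preHom g) U s) hx
    refine ⟨V, hV, hxV, ?_⟩
    rw [← ht, preHom_zero, app_zero, map_zero, hqm, ← hιq, ht, res_app, ← app_comp, ← preHom_comp,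
      hg, preHom_zero, app_zero]
  have : Epi ρ := epi_of_locally _ hρ
  refine ⟨ι, w, { exact := exact_of_locally _ fun U s hs x hx => ?_ }⟩
  obtain ⟨V, hV, t, hxV, ht⟩ := hex U s hs x hx
  exact ⟨V, hV, app (preHom q) V t, hxV, (hιq V t).trans ht⟩

end Modules
end AlgebraicGeometry.Scheme

/-! ### Exterior powers, tensor products and pushforwards on sections -/

namespace AlgebraicGeometry.Scheme

variable {X : Scheme.{u}}

namespace Sec

variable {P Q : X.PresheafOfModules} {U V : X.Opens}

/-- A morphism of presheaves of modules from compatible linear maps on sections. -/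
def mkHom (f : ∀ U, Sec P U →ₗ[Γ(X, U)] Sec Q U)
    (hf : ∀ {U V : X.Opens} (h : V ≤ U) (s : Sec P U), res h (f U s) = f V (res h s)) : P ⟶ Q where
  app U := ModuleCat.ofHom (X := P.obj U) (Y := Q.obj U) (f U.unop)
  naturality {U V} i := by
    ext s
    exact (hf (leOfHom i.unop) s).symm

/-- The presheaf exterior power. -/
abbrev extPre (k : ℕ) (P : X.PresheafOfModules) : X.PresheafOfModules :=
  (PresheafOfModules.exteriorPower (R := X.presheaf) k).obj P

/-- The presheaf exterior power of a morphism. -/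
abbrev extMap (k : ℕ) (φ : P ⟶ Q) : extPre k P ⟶ extPre k Q :=
  (PresheafOfModules.exteriorPower (R := X.presheaf) k).map φ

/-- Sections of the presheaf exterior power. -/
def extEquiv (k : ℕ) (P : X.PresheafOfModules) (U : X.Opens) :
    ⋀[Γ(X, U)]^k (Sec P U) ≃ₗ[Γ(X, U)]
      Sec (extPre k P) U :=
  LinearEquiv.refl _ _

lemma res_extEquiv_ιMulti (k : ℕ) (h : V ≤ U) (m : Fin k → Sec P U) :
    res h (extEquiv k P U (exteriorPower.ιMulti _ k m)) =
      extEquiv k P V (exteriorPower.ιMulti _ k fun i => res h (m i)) :=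
  PresheafOfModules.exteriorRes_ιMulti (R := X.presheaf) P k (homOfLE h).op m

lemma app_extEquiv (k : ℕ) (φ : P ⟶ Q) (x : ⋀[Γ(X, U)]^k (Sec P U)) :
    app (extMap k φ) U (extEquiv k P U x) =
      extEquiv k Q U (exteriorPower.map k (app φ U) x) := rfl

end Sec

namespace Modules

open Sec

open scoped TensorProduct

variable {M N M' N' T : X.Modules} {P Q : X.PresheafOfModules} {U V : X.Opens}

/-- The morphism from a sheafification given by a morphism of presheaves. -/
def sheafifyDesc (φ : P ⟶ pre M) : (sheafify X).obj P ⟶ M :=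
  ((PresheafOfModules.sheafificationAdjunction (𝟙 X.ringCatSheaf.obj)).homEquiv P M).symm φ

lemma app_sheafifyDesc (φ : P ⟶ pre M) (s : Sec P U) :
    app (preHom (sheafifyDesc φ)) U (app (toSheafify P) U s) = app φ U s := by
  let adj := PresheafOfModules.sheafificationAdjunction (𝟙 X.ringCatSheaf.obj)
  have h : toSheafify P ≫ preHom (sheafifyDesc φ) = φ :=
    (adj.homEquiv_unit _ _ _).symm.trans ((adj.homEquiv P M).apply_symm_apply φ)
  rw [← app_comp, h]

lemma app_sheafify_map (φ : P ⟶ Q) (s : Sec P U) :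
    app (preHom ((sheafify X).map φ)) U (app (toSheafify P) U s) =
      app (toSheafify Q) U (app φ U s) := by
  have h : φ ≫ toSheafify Q = toSheafify P ≫ preHom ((sheafify X).map φ) :=
    (PresheafOfModules.sheafificationAdjunction (𝟙 X.ringCatSheaf.obj)).unit.naturality φ
  rw [← app_comp, ← app_comp, h]

/-- Sections of the presheaf tensor product. -/
def tensorEquiv (M N : X.Modules) (U : X.Opens) :
    Sec (pre M) U ⊗[Γ(X, U)] Sec (pre N) U ≃ₗ[Γ(X, U)] Sec (presheafTensor M N) U :=
  LinearEquiv.refl _ _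

lemma res_tensorEquiv_tmul (h : V ≤ U) (m : Sec (pre M) U) (n : Sec (pre N) U) :
    res h (tensorEquiv M N U (m ⊗ₜ n)) = tensorEquiv M N V (res h m ⊗ₜ res h n) := rfl

/-- The morphism of presheaf tensor products. -/
def presheafTensorMap (φ : M ⟶ M') (ψ : N ⟶ N') : presheafTensor M N ⟶ presheafTensor M' N' :=
  PresheafOfModules.Monoidal.tensorHom (R := X.presheaf) φ.val ψ.val

lemma app_presheafTensorMap_tmul (φ : M ⟶ M') (ψ : N ⟶ N') (m : Sec (pre M) U) (n : Sec (pre N) U) :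
    app (presheafTensorMap φ ψ) U (tensorEquiv M N U (m ⊗ₜ n)) =
      tensorEquiv M' N' U (app (preHom φ) U m ⊗ₜ app (preHom ψ) U n) := rfl

/-- The unit section of the structure sheaf. -/
def ringEquiv (U : X.Opens) : Γ(X, U) ≃ₗ[Γ(X, U)] Sec (pre (structureSheaf X)) U :=
  LinearEquiv.refl _ _

lemma res_ringEquiv (h : V ≤ U) (r : Γ(X, U)) : res h (ringEquiv U r) = ringEquiv V
    (ringRes h r) := rfl

section pushforward
variable {Y : Scheme.{u}} (f : Y ⟶ X) (E : Y.Modules)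

/-- Sections of a pushforward. -/
def pushEquiv (E : Y.Modules) (U : X.Opens) :
    Sec (pre ((pushforward f).obj E)) U ≃+ Sec (pre E) (f ⁻¹ᵁ U) := AddEquiv.refl _

lemma pushEquiv_smul (r : Γ(X, U)) (s : Sec (pre ((pushforward f).obj E)) U) :
    pushEquiv f E U (r • s) = f.app U r • pushEquiv f E U s := rfl

lemma pushEquiv_res (h : V ≤ U) (s : Sec (pre ((pushforward f).obj E)) U) :
    pushEquiv f E V (res h s) = res (f.preimage_mono h) (pushEquiv f E U s) := rfl

lemma app_unitToPushforward (U : X.Opens) (r : Γ(X, U)) :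
   pushEquiv f (structureSheaf Y) U (app (preHom (N := (pushforward f).obj (structureSheaf Y))
     (SheafOfModules.unitToPushforwardObjUnit f.toRingCatSheafHom)) U (ringEquiv U r)) =
     ringEquiv _ (f.app U r) := rfl
end pushforward

end Modules
end AlgebraicGeometry.Scheme

/-! ### Homogeneous fractions on `Proj` and division by `f` -/

namespace AlgebraicGeometry.Proj

variable {A : Type u} {σ : Type v} [CommRing A] [SetLike σ A] [AddSubgroupClass σ A]
variable {𝒜 : ℕ → σ} [GradedRing 𝒜]

/-- A point of `Proj 𝒜`, as a homogeneous prime ideal. -/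
def prime (x : Proj 𝒜) : ProjectiveSpectrum 𝒜 := x

/-- The localization of `A` at a point of `Proj 𝒜`. -/
abbrev Loc (x : Proj 𝒜) : Type u := LocAt 𝒜 (prime x)

/-- `s` is locally a fraction of homogeneous elements of degree `a`. -/
def IsTwisted (a : ℤ) {U : (Proj 𝒜).Opens} (s : ∀ x ∈ U, Loc x) : Prop :=
  ∀ x ∈ U, ∃ (V : (Proj 𝒜).Opens) (hV : V ≤ U), x ∈ V ∧ ∃ i j : ℕ, (i : ℤ) = j + a ∧
    ∃ r ∈ 𝒜 i, ∃ t ∈ 𝒜 j, ∀ (y : Proj 𝒜) (hy : y ∈ V), t ∉ (prime y).asHomogeneousIdeal ∧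
      s y (hV hy) * algebraMap A (Loc y) t = algebraMap A (Loc y) r

lemma eq_mk_iff {x : Proj 𝒜} {t : A} (h : t ∈ (prime x).asHomogeneousIdeal.toIdeal.primeCompl)
    (s : Loc x) (r : A) : s = Localization.mk r ⟨t, h⟩ ↔
      s * algebraMap A (Loc x) t = algebraMap A (Loc x) r := by
  rw [Localization.mk_eq_mk', IsLocalization.eq_mk'_iff_mul_eq]

/-- With denominators cleared, computations with local fractions become ring identities in the
localizations. -/
lemma isTwisted_iff {a : ℤ} {U : (Proj 𝒜).Opens} {s : ∀ x ∈ U, Loc x} :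
    IsTwisted a s ↔ (twistedPredicate 𝒜 a).pred (U := U) fun x => s x.1 x.2 := by
  constructor
  · intro hs x
    obtain ⟨V, hV, hxV, i, j, e, r, hr, t, ht, h⟩ := hs x.1 x.2
    exact ⟨V, hxV, homOfLE hV, i, j, e, r, hr, t, ht, fun y => (h y.1 y.2).1,
      fun y => (eq_mk_iff (h y.1 y.2).1 _ _).2 (h y.1 y.2).2⟩
  · intro hs x hx
    obtain ⟨V, hxV, ι, i, j, e, r, hr, t, ht, h, hs⟩ := hs ⟨x, hx⟩
    exact ⟨V, leOfHom ι, hxV, i, j, e, r, hr, t, ht, fun y hy => ⟨h ⟨y, hy⟩,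
      (eq_mk_iff (h ⟨y, hy⟩) _ _).1 (hs ⟨y, hy⟩)⟩⟩

lemma IsTwisted.mul {a b c : ℤ} {U : (Proj 𝒜).Opens} {s t : ∀ x ∈ U, Loc x}
    (hs : IsTwisted a s) (ht : IsTwisted b t) (habc : a + b = c) :
    IsTwisted c fun x hx => s x hx * t x hx := by
  subst habc
  intro x hx
  obtain ⟨V, hV, hxV, i, j, e, r, hr, q, hq, h⟩ := hs x hx
  obtain ⟨W, hW, hxW, i', j', e', r', hr', q', hq', h'⟩ := ht x hx
  refine ⟨V ⊓ W, inf_le_left.trans hV, ⟨hxV, hxW⟩, i + i', j + j', by push_cast; omega, r * r',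
    SetLike.mul_mem_graded hr hr', q * q', SetLike.mul_mem_graded hq hq', fun y hy =>
    ⟨(prime y).asHomogeneousIdeal.toIdeal.primeCompl.mul_mem (h y hy.1).1 (h' y hy.2).1, ?_⟩⟩
  rw [map_mul, map_mul, mul_mul_mul_comm, (h y hy.1).2, (h' y hy.2).2]

lemma isTwisted_const {d : ℕ} {f : A} (hf : f ∈ 𝒜 d) (U : (Proj 𝒜).Opens) :
    IsTwisted (U := U) (d : ℤ) fun x _ => algebraMap A (Loc x) f :=
  fun x hx => ⟨U, le_rfl, hx, d, 0, by simp, f, hf, 1, SetLike.GradedOne.one_mem, fun y hy =>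
    ⟨(prime y).asHomogeneousIdeal.toIdeal.primeCompl.one_mem, by rw [map_one, mul_one]⟩⟩

/-- The value at a point of a section of the structure sheaf. -/
def valAt {U : (Proj 𝒜).Opens} (x : Proj 𝒜) (hx : x ∈ U) : Γ(Proj 𝒜, U) →+* Loc x where
  toFun g := HomogeneousLocalization.val (g.1 ⟨x, hx⟩)
  map_one' := HomogeneousLocalization.val_one
  map_mul' g h := HomogeneousLocalization.val_mul (g.1 ⟨x, hx⟩) (h.1 ⟨x, hx⟩)
  map_zero' := HomogeneousLocalization.val_zero
  map_add' g h := HomogeneousLocalization.val_add (g.1 ⟨x, hx⟩) (h.1 ⟨x, hx⟩)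

lemma valAt_res {U V : (Proj 𝒜).Opens} (h : V ≤ U) (g : Γ(Proj 𝒜, U)) (x : Proj 𝒜) (hx : x ∈ V) :
    valAt x hx (Scheme.Sec.ringRes h g) = valAt x (h hx) g := rfl

lemma section_ext {U : (Proj 𝒜).Opens} {g h : Γ(Proj 𝒜, U)}
    (H : ∀ x hx, valAt x hx g = valAt x hx h) : g = h :=
  Subtype.ext <| funext fun x => HomogeneousLocalization.val_injective _ (H x.1 x.2)

lemma isTwisted_valAt {U : (Proj 𝒜).Opens} (g : Γ(Proj 𝒜, U)) :
    IsTwisted 0 fun x hx => valAt x hx g := by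
  intro x hx
  obtain ⟨W, hxW, κ, d, p, q, hq, hg⟩ := g.2 ⟨x, hx⟩
  exact ⟨W, leOfHom κ, hxW, d, d, by simp, p.1, p.2, q.1, q.2, fun y hy => ⟨hq ⟨y, hy⟩,
    (eq_mk_iff (hq ⟨y, hy⟩) _ _).1 (congrArg HomogeneousLocalization.val (hg ⟨y, hy⟩))⟩⟩

lemma exists_section {U : (Proj 𝒜).Opens} {s : ∀ x ∈ U, Loc x} (hs : IsTwisted 0 s) :
    ∃ g : Γ(Proj 𝒜, U), ∀ x hx, valAt x hx g = s x hx := by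
  have h1 : ∀ x : U, ∃ y : HomogeneousLocalization 𝒜 (prime
    x.1).asHomogeneousIdeal.toIdeal.primeCompl,
      HomogeneousLocalization.val y = s x.1 x.2 := by
    intro x
    obtain ⟨V, hV, hxV, i, j, e, r, hr, q, hq, h⟩ := hs x.1 x.2
    obtain rfl : i = j := by omega
    exact ⟨.mk ⟨i, ⟨r, hr⟩, ⟨q, hq⟩, (h x.1 hxV).1⟩, ((eq_mk_iff (h x.1 hxV).1 _ _).2
      (h x.1 hxV).2).symm⟩
  choose y hy using h1
  refine ⟨⟨y, fun x => ?_⟩, fun x hx => hy ⟨x, hx⟩⟩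
  obtain ⟨V, hV, hxV, i, j, e, r, hr, q, hq, h⟩ := hs x.1 x.2
  obtain rfl : i = j := by omega
  refine ⟨V, hxV, homOfLE hV, i, ⟨r, hr⟩, ⟨q, hq⟩, fun z => (h z.1 z.2).1, fun z => ?_⟩
  exact HomogeneousLocalization.val_injective _
    ((hy _).trans ((eq_mk_iff (h z.1 z.2).1 _ _).2 (h z.1 z.2).2))

/-- The section of the structure sheaf given by a degree zero function. -/
def ofTwisted {U : (Proj 𝒜).Opens} (s : ∀ x ∈ U, Loc x) (hs : IsTwisted 0 s) : Γ(Proj 𝒜, U) :=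
  (exists_section hs).choose

@[simp] lemma valAt_ofTwisted {U : (Proj 𝒜).Opens} (s : ∀ x ∈ U, Loc x) (hs : IsTwisted 0 s)
    (x : Proj 𝒜) (hx : x ∈ U) : valAt x hx (ofTwisted s hs) = s x hx :=
  (exists_section hs).choose_spec x hx

/-- The image of `ℓ` in a localization at a point where it does not vanish, as a unit. -/
def unitAt {ℓ : A} {x : Proj 𝒜} (h : ℓ ∉ (prime x).asHomogeneousIdeal) : (Loc x)ˣ :=
  (IsLocalization.map_units (Loc x) (⟨ℓ, h⟩ : (prime x).asHomogeneousIdeal.toIdeal.primeCompl)).unit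

section unitPow

variable {ℓ : A} {U : (Proj 𝒜).Opens} (hU : U ≤ basicOpen 𝒜 ℓ)

/-- The integral powers of `ℓ` on an open set where `ℓ` does not vanish. -/
def unitPow (hU : U ≤ basicOpen 𝒜 ℓ) (a : ℤ) (x : Proj 𝒜) (hx : x ∈ U) : Loc x :=
  ((unitAt (x := x) (hU hx) ^ a : (Loc x)ˣ) : Loc x)

lemma unitPow_add (a b : ℤ) (x : Proj 𝒜) (hx : x ∈ U) :
    unitPow hU a x hx * unitPow hU b x hx = unitPow hU (a + b) x hx := by
  rw [unitPow, unitPow, ← Units.val_mul, ← zpow_add]; rfl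

@[simp] lemma unitPow_zero (x : Proj 𝒜) (hx : x ∈ U) : unitPow hU 0 x hx = 1 := by
  rw [unitPow, zpow_zero, Units.val_one]

lemma unitPow_natCast (n : ℕ) (x : Proj 𝒜) (hx : x ∈ U) :
    unitPow hU n x hx = algebraMap A (Loc x) (ℓ ^ n) := by
  rw [unitPow, zpow_natCast, Units.val_pow_eq_pow_val, map_pow]; rfl

lemma unitPow_pow (a : ℤ) (n : ℕ) (x : Proj 𝒜) (hx : x ∈ U) :
    unitPow hU a x hx ^ n = unitPow hU (a * n) x hx := by
  rw [unitPow, ← Units.val_pow_eq_pow_val, ← zpow_natCast, ← zpow_mul]; rfl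

lemma isUnit_unitPow (a : ℤ) (x : Proj 𝒜) (hx : x ∈ U) : IsUnit (unitPow hU a x hx) :=
    Units.isUnit _

lemma isTwisted_unitPow (hℓ : ℓ ∈ 𝒜 1) (a : ℤ) : IsTwisted a (unitPow hU a) := by
  refine fun x hx => ⟨U, le_rfl, hx, a.toNat, (-a).toNat, by omega, ℓ ^ a.toNat,
    by simpa using SetLike.pow_mem_graded a.toNat hℓ, ℓ ^ (-a).toNat,
    by simpa using SetLike.pow_mem_graded (-a).toNat hℓ, fun y hy =>
      ⟨(prime y).asHomogeneousIdeal.toIdeal.primeCompl.pow_mem (hU hy) _, ?_⟩⟩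
  rw [← unitPow_natCast hU _ y hy, ← unitPow_natCast hU _ y hy, unitPow_add]
  congr 1
  omega

end unitPow

section dehomog

variable {ℓ : A} (hℓ : ℓ ∈ 𝒜 1) {d : ℕ} {f : A} (hf : f ∈ 𝒜 d) {U V : (Proj 𝒜).Opens}
  (hU : U ≤ basicOpen 𝒜 ℓ)

/-- The function `f / ℓ ^ d` on an open set where `ℓ` does not vanish. -/
def dehomog : Γ(Proj 𝒜, U) :=
  ofTwisted _ ((isTwisted_const hf U).mul (isTwisted_unitPow hU hℓ (-(d : ℤ)))
    (add_neg_cancel (d : ℤ)))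

lemma valAt_dehomog (x : Proj 𝒜) (hx : x ∈ U) :
    valAt x hx (dehomog hℓ hf hU) = algebraMap A (Loc x) f * unitPow hU (-(d : ℤ)) x hx :=
  valAt_ofTwisted ..

lemma res_dehomog (h : V ≤ U) :
    Scheme.Sec.ringRes h (dehomog hℓ hf hU) = dehomog hℓ hf (h.trans hU) :=
  section_ext fun x hx => (valAt_dehomog hℓ hf hU x (h hx)).trans (valAt_dehomog hℓ hf _ x hx).symm

lemma dehomog_pow {e : ℕ} (n : ℕ) (he : e = n * d) (hfn : f ^ n ∈ 𝒜 e) :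
    dehomog hℓ hfn hU = dehomog hℓ hf hU ^ n := by
  refine section_ext fun x hx => ?_
  rw [map_pow, valAt_dehomog, valAt_dehomog, mul_pow, map_pow, unitPow_pow]
  subst he
  congr 2
  push_cast; ring

/-- On an open set where both `ℓ` and `ℓ'` do not vanish, `f / ℓ ^ d` is a multiple of
`f / ℓ' ^ d`. -/
lemma dehomog_dvd_dehomog {ℓ' : A} (hℓ' : ℓ' ∈ 𝒜 1) (hU' : U ≤ basicOpen 𝒜 ℓ') :
    dehomog hℓ' hf hU' ∣ dehomog hℓ hf hU := by
  -- The cofactor is `(ℓ' / ℓ) ^ d`.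
  refine ⟨ofTwisted _ ((isTwisted_unitPow hU' hℓ' (d : ℤ)).mul (isTwisted_unitPow hU hℓ (-(d : ℤ)))
    (add_neg_cancel (d : ℤ))), section_ext fun x hx => ?_⟩
  rw [map_mul, valAt_dehomog, valAt_dehomog, valAt_ofTwisted, mul_assoc,
    ← mul_assoc (unitPow _ _ _ _), unitPow_add, neg_add_cancel, unitPow_zero, one_mul]

lemma valAt_dehomog_mem (x : Proj 𝒜) (hx : x ∈ U) :
    valAt x hx (dehomog hℓ hf hU) ∈ Ideal.span {algebraMap A (Loc x) f} := by
  rw [valAt_dehomog]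
  exact Ideal.mul_mem_right _ _ (Ideal.mem_span_singleton_self _)

variable [IsDomain A]

instance (x : ProjectiveSpectrum 𝒜) : IsDomain (LocAt 𝒜 x) :=
  IsLocalization.isDomain_localization (Ideal.primeCompl_le_nonZeroDivisors
    x.asHomogeneousIdeal.toIdeal)

lemma algebraMap_loc_injective (x : Proj 𝒜) : Function.Injective (algebraMap A (Loc x)) :=
  IsLocalization.injective _ (Ideal.primeCompl_le_nonZeroDivisors
    (prime x).asHomogeneousIdeal.toIdeal)

lemma algebraMap_loc_ne_zero (x : Proj 𝒜) {f : A} (hf : f ≠ 0) : algebraMap A (Loc x) f ≠ 0 :=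
  (map_ne_zero_iff _ (algebraMap_loc_injective x)).2 hf

lemma dehomog_mem_nonZeroDivisors (hf0 : f ≠ 0) :
    dehomog hℓ hf hU ∈ nonZeroDivisors Γ(Proj 𝒜, U) := by
  rw [mem_nonZeroDivisors_iff_left]
  refine fun g hg => section_ext fun x hx => ?_
  have h := congrArg (valAt x hx) hg
  rw [map_mul, map_zero, valAt_dehomog] at h
  rw [map_zero]
  exact (mul_eq_zero.1 h).resolve_left
    (mul_ne_zero (algebraMap_loc_ne_zero _ hf0) (isUnit_unitPow hU _ x hx).ne_zero)

/-- A section whose values are divisible by `f` is a multiple of `f / ℓ ^ d`. -/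
lemma dehomog_dvd_of_divisible (hf0 : f ≠ 0) {s : Γ(Proj 𝒜, U)}
    (hs : ∀ x hx, valAt x hx s ∈ Ideal.span {algebraMap A (Loc x) f}) :
    dehomog hℓ hf hU ∣ s := by
  have h1 : ∀ x hx, ∃ c : Loc x, valAt x hx s = algebraMap A (Loc x) f * c :=
    fun x hx => by
      obtain ⟨c, hc⟩ := Ideal.mem_span_singleton'.1 (hs x hx)
      exact ⟨c, by rw [← hc, mul_comm]⟩
  choose c hc using h1
  -- The pointwise quotients `c = s / f` exist by assumption; what has to be shown is that near each
  -- point they are given by a single homogeneous fraction.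
  have hcT : IsTwisted (-(d : ℤ)) c := by
    intro x hx
    obtain ⟨W, hWU, hxW, e, e', he, p, hp, q, hq, hg⟩ := isTwisted_valAt s x hx
    beta_reduce at hg
    obtain rfl : e = e' := by omega
    obtain ⟨c', q', hc'⟩ := IsLocalization.exists_mk'_eq
      (prime x).asHomogeneousIdeal.toIdeal.primeCompl (c x hx)
    have h2 : p * q' = f * (c' * q) := by
      apply algebraMap_loc_injective x
      rw [map_mul, map_mul, map_mul, ← (hg x hxW).2, ← (IsLocalization.eq_mk'_iff_mul_eq.1
        hc'.symm), hc]
      ring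
    -- The denominator `q'` need not be homogeneous, but one of its components avoids the prime and
    -- can replace it.
    obtain ⟨n, hn⟩ : ∃ n, (DirectSum.decompose 𝒜 (q' : A) n : A) ∉
      (prime x).asHomogeneousIdeal.toIdeal := by
      classical
      by_contra! h
      apply q'.2
      rw [← DirectSum.sum_support_decompose 𝒜 (q' : A)]
      exact Ideal.sum_mem _ fun i _ => h i
    set t : A := (DirectSum.decompose 𝒜 (q' : A) n : A) with ht
    have htn : t ∈ 𝒜 n := (DirectSum.decompose 𝒜 (q' : A) n).2
    -- Take the component of degree `e + n` in `p * q' = f * (c' * q)`. If `e + n < d` the right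
    -- side has no such component, and `y = 0`.
    obtain ⟨y, hy, hyd⟩ : ∃ y : A, p * t = f * y ∧ y * ℓ ^ d ∈ 𝒜 (e + n) := by
      have h3 : p * t = DirectSum.decompose 𝒜 (f * (c' * q)) (e + n) := by
        rw [← h2, DirectSum.coe_decompose_mul_add_of_left_mem 𝒜 hp]
      by_cases hd : d ≤ e + n
      · rw [DirectSum.coe_decompose_mul_of_left_mem_of_le 𝒜 hf hd] at h3
        refine ⟨_, h3, ?_⟩
        have := SetLike.mul_mem_graded (DirectSum.decompose 𝒜 (c' * q) (e + n - d)).2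
          (by simpa using SetLike.pow_mem_graded d hℓ : ℓ ^ d ∈ 𝒜 d)
        rwa [Nat.sub_add_cancel hd] at this
      · rw [DirectSum.coe_decompose_mul_of_left_mem_of_not_le 𝒜 hf hd] at h3
        exact ⟨0, by rw [h3, mul_zero], by rw [zero_mul]; exact zero_mem _⟩
    -- Near `x` one has `c = y / (q t)`. The common factor `ℓ ^ d` gives the numerator the
    -- natural-number degree `e + n` in both cases.
    refine ⟨W ⊓ basicOpen 𝒜 t, inf_le_left.trans hWU, ⟨hxW, hn⟩, e + n, e + n + d,
      by push_cast; ring, y * ℓ ^ d, hyd, q * t * ℓ ^ d,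
      SetLike.mul_mem_graded (SetLike.mul_mem_graded hq htn)
        (by simpa using SetLike.pow_mem_graded d hℓ), fun z hz =>
        ⟨(prime z).asHomogeneousIdeal.toIdeal.primeCompl.mul_mem
          ((prime z).asHomogeneousIdeal.toIdeal.primeCompl.mul_mem (hg z hz.1).1 hz.2)
          ((prime z).asHomogeneousIdeal.toIdeal.primeCompl.pow_mem (hU (hWU hz.1)) d), ?_⟩⟩
    apply mul_left_cancel₀ (algebraMap_loc_ne_zero z hf0)
    have h4 := congrArg (algebraMap A (Loc z)) hy
    simp only [map_mul] at h4 ⊢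
    rw [← mul_assoc (algebraMap A (Loc z) f) (algebraMap A (Loc z) y), ← h4, ← (hg z hz.1).2, hc]
    ring
  refine ⟨ofTwisted _ (hcT.mul (isTwisted_unitPow hU hℓ (d : ℤ)) (neg_add_cancel (d : ℤ))),
    section_ext fun x hx => ?_⟩
  rw [map_mul, valAt_dehomog, valAt_ofTwisted, hc, mul_comm (c x hx), ← mul_assoc,
    mul_assoc (algebraMap A (Loc x) f), unitPow_add, neg_add_cancel, unitPow_zero, mul_one]

end dehomog

end AlgebraicGeometry.Proj

/-! ### Semilinear exterior powers; tensoring with a cyclic module -/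

section

variable {R S M N : Type*} [CommRing R] [CommRing S] [AddCommGroup M] [Module R M]
  [AddCommGroup N] [Module S N]

/-- The map of exterior powers induced by a semilinear map. -/
def exteriorPower.mapSemilinear (π : R →+* S) (ε : M →ₛₗ[π] N) (k : ℕ) : ⋀[R]^k M →ₛₗ[π] ⋀[S]^k N :=
  -- Restricting scalars along `π` turns the semilinear alternating map into a linear one, to which
  -- the universal property applies.
  letI : Module R (⋀[S]^k N) := Module.compHom _ π
  let h : M [⋀^Fin k]→ₗ[R] ⋀[S]^k N :=
    { toFun m := ιMulti S k fun i => ε (m i)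
      map_update_add' := by
        intro _ m i x y
        have h : ∀ z, (fun j => ε (Function.update m i z j)) =
            Function.update (fun j => ε (m j)) i (ε z) := fun z =>
          funext (Function.apply_update (fun _ t => ε t) m i z)
        simp only [h, map_add]
        exact (ιMulti S k).map_update_add _ i _ _
      map_update_smul' := by
        intro _ m i r x
        have h : ∀ z, (fun j => ε (Function.update m i z j)) =
            Function.update (fun j => ε (m j)) i (ε z) := fun z =>
          funext (Function.apply_update (fun _ t => ε t) m i z)
        simp only [h, map_smulₛₗ]
        exact (ιMulti S k).map_update_smul _ i _ _
      map_eq_zero_of_eq' := by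
        intro m i j h hij
        exact (ιMulti S k).map_eq_zero_of_eq (fun i => ε (m i)) (congrArg ε h) hij }
  { toFun := alternatingMapLinearEquiv h
    map_add' := map_add _
    map_smul' := fun r x => (alternatingMapLinearEquiv h).map_smul r x }

lemma exteriorPower.mapSemilinear_ιMulti (π : R →+* S) (ε : M →ₛₗ[π] N) (k : ℕ) (m : Fin k → M) :
    mapSemilinear π ε k (ιMulti R k m) = ιMulti S k fun i => ε (m i) :=
  letI : Module R (⋀[S]^k N) := Module.compHom _ π
  alternatingMapLinearEquiv_apply_ιMulti _ _

lemma exteriorPower.induction_span {k : ℕ} {p : ⋀[R]^k M → Prop} (w : ⋀[R]^k M)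
    (h : ∀ m, p (ιMulti R k m)) (h0 : p 0) (hadd : ∀ x y, p x → p y → p (x + y))
    (hsmul : ∀ (r : R) x, p x → p (r • x)) : p w := by
  have hw : w ∈ Submodule.span R (Set.range (ιMulti R k (M := M))) := by
    rw [ιMulti_span]; trivial
  induction hw using Submodule.span_induction with
  | mem w hw => obtain ⟨m, rfl⟩ := hw; exact h m
  | zero => exact h0
  | add x y _ _ hx hy => exact hadd x y hx hy
  | smul r x _ hx => exact hsmul r x hx

lemma exteriorPower.mapSemilinear_surjective (π : R →+* S) (hπ : Function.Surjective π)
    (ε : M →ₛₗ[π] N) (hε : Function.Surjective ε) (k : ℕ) :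
    Function.Surjective (mapSemilinear π ε k) := by
  intro w
  induction w using exteriorPower.induction_span with
  | h m =>
    choose y hy using fun i => hε (m i)
    exact ⟨ιMulti R k y, by rw [mapSemilinear_ιMulti, funext hy]⟩
  | h0 => exact ⟨0, map_zero _⟩
  | hadd x y hx hy =>
    obtain ⟨x, rfl⟩ := hx
    obtain ⟨y, rfl⟩ := hy
    exact ⟨x + y, map_add _ _ _⟩
  | hsmul r x hx =>
    obtain ⟨x, rfl⟩ := hx
    obtain ⟨r, rfl⟩ := hπ r
    exact ⟨r • x, map_smulₛₗ _ _ _⟩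

open scoped TensorProduct

variable {L : Type*} [AddCommGroup L] [Module R L]

lemma TensorProduct.exists_eq_tmul_of_surjective (t : L)
    (ht : Function.Surjective fun r : R => r • t) (z : M ⊗[R] L) : ∃ m : M, z = m ⊗ₜ[R] t := by
  induction z using TensorProduct.induction_on with
  | zero => exact ⟨0, by simp⟩
  | tmul m l =>
    obtain ⟨r, rfl⟩ := ht l
    exact ⟨r • m, (TensorProduct.smul_tmul r m t).symm⟩
  | add x y hx hy =>
    obtain ⟨x, rfl⟩ := hx
    obtain ⟨y, rfl⟩ := hy
    exact ⟨x + y, (TensorProduct.add_tmul x y t).symm⟩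

/-- The hypotheses say that `L` is `R / a` with generator `t`, so by right exactness `M ⊗ L` is `M /
aM`. -/
lemma TensorProduct.exists_eq_smul_of_tmul_eq_zero (t : L)
    (ht : Function.Surjective fun r : R => r • t) (a : R) (ha : ∀ r : R, r • t = 0 → a ∣ r)
    (ha' : a • t = 0) (m : M) (h : m ⊗ₜ[R] t = 0) : ∃ m' : M, m = a • m' := by
  have hex : Function.Exact (LinearMap.lsmul R R a) (LinearMap.toSpanSingleton R L t) := by
    intro r
    constructor
    · intro hr
      obtain ⟨c, hc⟩ := ha r hr
      exact ⟨c, hc.symm⟩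
    · rintro ⟨c, rfl⟩
      simp only [LinearMap.lsmul_apply, smul_eq_mul, LinearMap.toSpanSingleton_apply]
      rw [mul_comm, mul_smul, ha', smul_zero]
  have h1 := lTensor_exact M hex ht
  obtain ⟨z, hz⟩ := (h1 (m ⊗ₜ 1)).1 (by simpa using h)
  obtain ⟨m', rfl⟩ := TensorProduct.exists_eq_tmul_of_surjective (1 : R) (fun r => ⟨r, by simp⟩) z
  refine ⟨m', ?_⟩
  have := congrArg (TensorProduct.rid R M) hz
  simpa using this.symm

lemma TensorProduct.eq_zero_of_tmul_eq_zero (t : L)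
    (ht : Function.Bijective fun r : R => r • t) (m : M) (h : m ⊗ₜ[R] t = 0) : m = 0 := by
  obtain ⟨m', rfl⟩ := TensorProduct.exists_eq_smul_of_tmul_eq_zero t ht.2 0
    (fun r hr => by rw [ht.1 (hr.trans (zero_smul R t).symm : (fun r : R => r • t) r = (fun r :
      R => r • t) 0)]) (zero_smul _ _) m h
  exact zero_smul _ _

end

/-! ### Local representatives; the morphisms out of `⋀ᵏ M ⊗ L` -/

namespace AlgebraicGeometry.Scheme.Modules

open Sec

open scoped TensorProduct

variable {X Y : Scheme.{u}} {M N L : X.Modules} {U V : X.Opens}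

lemma exists_tensor_eq (z : Sec (pre (tensor M L)) U) {x : X} (hx : x ∈ U) {V₀ : X.Opens} (hxV :
    x ∈ V₀)
    (t : Sec (pre L) V₀) (ht : ∀ V (h : V ≤ V₀), IsAffineOpen V →
      Function.Surjective fun r : Γ(X, V) => r • res h t) :
    ∃ (V : X.Opens) (hV : V ≤ U) (hV₀ : V ≤ V₀) (m : Sec (pre M) V), x ∈ V ∧ IsAffineOpen V ∧
      app (toSheafify _) V (tensorEquiv M L V (m ⊗ₜ res hV₀ t)) = res hV z := by
  obtain ⟨V, hV, y, hxV', hy⟩ := toSheafify_lift (presheafTensor M L) z hx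
  obtain ⟨W, hW, hxW, hWV⟩ := exists_isAffineOpen_mem_and_subset (U := V ⊓ V₀) ⟨hxV', hxV⟩
  have hWV' : W ≤ V := fun z hz => (hWV hz).1
  have hWV₀ : W ≤ V₀ := fun z hz => (hWV hz).2
  obtain ⟨m, hm⟩ := TensorProduct.exists_eq_tmul_of_surjective (res hWV₀ t) (ht W hWV₀ hW)
    ((tensorEquiv M L W).symm (res hWV' y))
  refine ⟨W, hWV'.trans hV, hWV₀, m, hxW, hW, ?_⟩
  rw [← hm, LinearEquiv.apply_symm_apply, ← res_app, hy]
  exact res_res hV hWV' z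

section pushforward

variable (j : Y ⟶ X) [IsClosedImmersion j]

lemma exists_preimage_le {x : X} (hx : x ∈ U) (hxj : x ∉ Set.range j) :
    ∃ V ≤ U, x ∈ V ∧ j ⁻¹ᵁ V = ⊥ := by
  refine ⟨U ⊓ ⟨(Set.range j)ᶜ, j.isClosedEmbedding.isClosed_range.isOpen_compl⟩, inf_le_left, ⟨hx,
    hxj⟩, ?_⟩
  ext y
  simp

lemma exists_preimage_le_of_mem {y : Y} {W : Y.Opens} (hW : y ∈ W) (hy : j y ∈ U) :
    ∃ V ≤ U, j y ∈ V ∧ j ⁻¹ᵁ V ≤ W := by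
  obtain ⟨V, hV, hVW⟩ := j.isClosedEmbedding.isInducing.isOpen_iff.1 W.2
  refine ⟨U ⊓ ⟨V, hV⟩, inf_le_left, ⟨hy, ?_⟩, ?_⟩
  · change y ∈ j ⁻¹' V
    rw [hVW]; exact hW
  · intro z hz
    exact hVW.le hz.2

instance {W : Y.Opens} (P : Y.PresheafOfModules) [Subsingleton Γ(Y, W)] : Subsingleton (Sec P W) :=
  Module.subsingleton Γ(Y, W) _

/-- Sections of a sheafification lift only near points of `Y`, whereas a neighbourhood in `X` is
wanted. For a closed immersion, preimages of opens of `X` are cofinal among neighbourhoods of a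
point of `Y`, and points off the image have neighbourhoods with empty preimage. -/
lemma exists_res_pushforward_eq {P : Y.PresheafOfModules}
    (s : Sec (pre ((sheafify Y).obj P)) (j ⁻¹ᵁ U)) {x : X} (hx : x ∈ U) :
    ∃ (V : X.Opens) (hV : V ≤ U) (t : Sec P (j ⁻¹ᵁ V)), x ∈ V ∧
      app (toSheafify P) _ t = res (j.preimage_mono hV) s := by
  by_cases hxj : x ∈ Set.range j
  · obtain ⟨y, rfl⟩ := hxj
    obtain ⟨W, hW, t, hyW, ht⟩ := toSheafify_lift P s (x := y) hx
    obtain ⟨V, hV, hyV, hVW⟩ := exists_preimage_le_of_mem j hyW hx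
    refine ⟨V, hV, res hVW t, hyV, ?_⟩
    rw [← res_app, ht, res_res]
  · obtain ⟨V, hV, hxV, h⟩ := exists_preimage_le j hx hxj
    have : Subsingleton Γ(Y, j ⁻¹ᵁ V) := by rw [h]; infer_instance
    exact ⟨V, hV, 0, hxV, Subsingleton.elim _ _⟩

lemma exists_res_pushforward_eq_zero {P : Y.PresheafOfModules}
    (s : Sec P (j ⁻¹ᵁ U)) (hs : app (toSheafify P) _ s = 0) {x : X} (hx : x ∈ U) :
    ∃ (V : X.Opens) (hV : V ≤ U), x ∈ V ∧ res (j.preimage_mono hV) s = 0 := by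
  by_cases hxj : x ∈ Set.range j
  · obtain ⟨y, rfl⟩ := hxj
    obtain ⟨W, hW, hyW, ht⟩ := toSheafify_res_eq P s hs (x := y) hx
    obtain ⟨V, hV, hyV, hVW⟩ := exists_preimage_le_of_mem j hyW hx
    refine ⟨V, hV, hyV, ?_⟩
    rw [← res_res hW hVW, ht, map_zero]
  · obtain ⟨V, hV, hxV, h⟩ := exists_preimage_le j hx hxj
    have : Subsingleton Γ(Y, j ⁻¹ᵁ V) := by rw [h]; infer_instance
    exact ⟨V, hV, hxV, Subsingleton.elim _ _⟩

end pushforward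

section wedge

variable (j : Y ⟶ X) {E : Y.Modules} (ε : M ⟶ (pushforward j).obj E) (k : ℕ)

/-- A morphism `M ⟶ j_* E` on sections, as a semilinear map. -/
def appPush (U : X.Opens) : Sec (pre M) U →ₛₗ[(j.app U).hom] Sec (pre E) (j ⁻¹ᵁ U) where
  toFun s := pushEquiv j E U (app (preHom ε) U s)
  map_add' s t := by rw [map_add, map_add]
  map_smul' r s := by rw [LinearMap.map_smul, pushEquiv_smul]

lemma res_appPush (h : V ≤ U) (s : Sec (pre M) U) :
    res (j.preimage_mono h) (appPush j ε U s) = appPush j ε V (res h s) := by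
  change res (j.preimage_mono h) (pushEquiv j E U _) = pushEquiv j E V _
  rw [← pushEquiv_res, res_app]

/-- The map `⋀ᵏ M(U) ⟶ ⋀ᵏ E(j⁻¹ U)`. -/
def wedgePush (U : X.Opens) : Sec (extPre k (pre M)) U →ₛₗ[(j.app U).hom] Sec (extPre k (pre E))
    (j ⁻¹ᵁ U) :=
  ((extEquiv k (pre E) (j ⁻¹ᵁ U)).toLinearMap.comp
    (exteriorPower.mapSemilinear (j.app U).hom (appPush j ε U) k)).comp (extEquiv k
      (pre M) U).symm.toLinearMap

lemma wedgePush_extEquiv (w : ⋀[Γ(X, U)]^k (Sec (pre M) U)) :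
    wedgePush j ε k U (extEquiv k (pre M) U w) = extEquiv k (pre E) (j ⁻¹ᵁ U)
      (exteriorPower.mapSemilinear (j.app U).hom (appPush j ε U) k w) := rfl

lemma ringRes_app (h : V ≤ U) (r : Γ(X, U)) :
    ringRes (j.preimage_mono h) ((j.app U).hom r) = (j.app V).hom (ringRes h r) :=
  congr($(j.naturality (homOfLE h).op).hom r).symm

lemma res_wedgePush (h : V ≤ U) (s : Sec (extPre k (pre M)) U) :
    res (j.preimage_mono h) (wedgePush j ε k U s) = wedgePush j ε k V (res h s) := by
  obtain ⟨w, rfl⟩ := (extEquiv k (pre M) U).surjective s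
  induction w using exteriorPower.induction_span with
  | h m =>
    rw [res_extEquiv_ιMulti, wedgePush_extEquiv, wedgePush_extEquiv,
      exteriorPower.mapSemilinear_ιMulti, exteriorPower.mapSemilinear_ιMulti, res_extEquiv_ιMulti]
    exact congrArg _ (congrArg _ (funext fun i => res_appPush j ε h (m i)))
  | h0 => rw [map_zero, map_zero, map_zero, map_zero, map_zero]
  | hadd x y hx hy => rw [map_add, map_add, map_add, map_add, map_add, hx, hy]
  | hsmul r x hx =>
    rw [LinearEquiv.map_smul, map_smulₛₗ, map_smulₛₗ, map_smulₛₗ, map_smulₛₗ, hx, ringRes_app]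

/-- The exterior power of a sheaf of modules. -/
abbrev ext (k : ℕ) (M : X.Modules) : X.Modules := (sheafify X).obj (extPre k (pre M))

/-- The morphism `⋀ᵏ M ⟶ j_* ⋀ᵏ E` induced by `M ⟶ j_* E`. -/
def wedgePushHom : ext k M ⟶ (pushforward j).obj (ext k E) :=
  sheafifyDesc (mkHom (fun U =>
    { toFun s := (pushEquiv j (ext k E) U).symm
        (app (toSheafify (extPre k (pre E))) _ (wedgePush j ε k U s))
      map_add' s t := by rw [map_add, map_add, map_add]
      map_smul' r s := by
        rw [map_smulₛₗ, LinearMap.map_smul]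
        rfl }) (fun {U V} h s => by
          apply (pushEquiv j (ext k E) V).injective
          rw [pushEquiv_res]
          change res _ (app (toSheafify (extPre k (pre E))) _ (wedgePush j ε k U s)) =
            app (toSheafify (extPre k (pre E))) _ (wedgePush j ε k V (res h s))
          rw [res_app, res_wedgePush]))

lemma app_wedgePushHom (s : Sec (extPre k (pre M)) U) :
    pushEquiv j (ext k E) U (app (preHom (wedgePushHom j ε k)) U
      (app (toSheafify (extPre k (pre M))) U s)) =
      app (toSheafify (extPre k (pre E))) _ (wedgePush j ε k U s) :=
  congrArg (pushEquiv j (ext k E) U) (app_sheafifyDesc _ s)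

end wedge

section tensor

/-- The morphism `M ⊗ L ⟶ M'` given by `p : M ⟶ M'` and a function `μ : L ⟶ 𝒪_X`. -/
def tensorContract {M' : X.Modules} (p : M ⟶ M') (μ : L ⟶ structureSheaf X) : tensor M L ⟶ M' :=
  sheafifyDesc (mkHom (P := presheafTensor M L) (Q := pre M')
    (fun U => (TensorProduct.lift ((LinearMap.lsmul Γ(X, U) (Sec (pre M') U)).flip.compl₁₂
      (app (preHom p) U) ((ringEquiv U).symm.toLinearMap.comp (app (preHom μ) U)))).comp
      (tensorEquiv M L U).symm.toLinearMap)
    (fun {U V} h s => by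
      obtain ⟨z, rfl⟩ := (tensorEquiv M L U).surjective s
      induction z using TensorProduct.induction_on with
      | zero => simp
      | tmul m l =>
        rw [res_tensorEquiv_tmul]
        simp only [LinearMap.comp_apply, LinearEquiv.coe_coe, LinearEquiv.symm_apply_apply,
          TensorProduct.lift.tmul, LinearMap.compl₁₂_apply, LinearMap.flip_apply,
          LinearMap.lsmul_apply, map_smulₛₗ]
        rw [← res_app, ← res_app]
        rfl
      | add x y hx hy => simp only [map_add, hx, hy]))

lemma app_tensorContract {M' : X.Modules} (p : M ⟶ M') (μ : L ⟶ structureSheaf X)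
    (m : Sec (pre M) U) (l : Sec (pre L) U) :
    app (preHom (tensorContract p μ)) U (app (toSheafify _) U (tensorEquiv M L U (m ⊗ₜ l))) =
      (ringEquiv U).symm (app (preHom μ) U l) • app (preHom p) U m :=
  app_sheafifyDesc _ _

end tensor

end AlgebraicGeometry.Scheme.Modules

/-! ### From local charts to the short exact sequence -/

namespace AlgebraicGeometry.Scheme.Modules

open Sec

open scoped TensorProduct

variable {X Y Z : Scheme.{u}}

/-- Local data on the open set `V` under which a presentation `M₁ ⟶ M₀ ⟶ j_* E` on a hypersurface
with equation `g` is exact on sections, with `M₀` projective and `E` free of rank `r`, and `t`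
generates `L`, with `μ t = g ^ (k - 1)`. -/
structure IsWedgeChart (j : Y ⟶ X) (i : Z ⟶ X) {M₁ M₀ L : X.Modules} {E : Y.Modules}
    (φ : M₁ ⟶ M₀) (ε : M₀ ⟶ (pushforward j).obj E) (μ : L ⟶ structureSheaf X) (k r : ℕ)
    (V : X.Opens) (t : Sec (pre L) V) (g : Γ(X, V)) : Prop where
  bijective : Function.Bijective fun c : Γ(X, V) => c • t
  app_eq : (ringEquiv V).symm (app (preHom μ) V t) = g ^ (k - 1)
  surjective : Function.Surjective (j.app V).hom
  ker : ∀ c, (j.app V).hom c = 0 ↔ g ∣ c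
  surjective' : Function.Surjective (i.app V).hom
  ker' : ∀ c, (i.app V).hom c = 0 ↔ g ^ (k - 1) ∣ c
  mem_nonZeroDivisors : g ∈ nonZeroDivisors Γ(X, V)
  projective : Module.Projective Γ(X, V) (Sec (pre M₀) V)
  exact : ∀ y, appPush j ε V y = 0 ↔ ∃ z, app (preHom φ) V z = y
  surjective_appPush : Function.Surjective (appPush j ε V)
  basis : Nonempty (Module.Basis (Fin r) Γ(Y, j ⁻¹ᵁ V) (Sec (pre E) (j ⁻¹ᵁ V)))

section

variable {j : Y ⟶ X} {i : Z ⟶ X} {M₁ M₀ L : X.Modules} {E : Y.Modules}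
    {φ : M₁ ⟶ M₀} {ε : M₀ ⟶ (pushforward j).obj E} {μ : L ⟶ structureSheaf X} {k r : ℕ}
    {U V W : X.Opens} {t : Sec (pre L) V} {g : Γ(X, V)}

lemma IsWedgeChart.wedgePush_eq_zero_iff (h : IsWedgeChart j i φ ε μ k r V t g) (hk : 1 ≤ k)
   (w : Sec (extPre k (pre M₀)) V) :
    wedgePush j ε k V w = 0 ↔ ∃ z, app (extMap k (preHom φ)) V z = g ^ (k - 1) • w := by
  obtain ⟨b⟩ := h.basis
  have := h.projective
  obtain ⟨w, rfl⟩ := (extEquiv k (pre M₀) V).surjective w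
  refine (exteriorPower.eq_zero_iff_pow_smul_mem_range (j.app V).hom h.surjective g h.ker
    h.mem_nonZeroDivisors (app (preHom φ) V) (appPush j ε V) h.exact h.surjective_appPush b hk
    (exteriorPower.mapSemilinear (j.app V).hom (appPush j ε V) k)
    (exteriorPower.mapSemilinear_ιMulti _ _ _) w).trans ⟨?_, ?_⟩
  · rintro ⟨z, hz⟩
    exact ⟨extEquiv k _ V z, by rw [app_extEquiv, hz, LinearEquiv.map_smul]⟩
  · rintro ⟨z, hz⟩
    obtain ⟨z, rfl⟩ := (extEquiv k _ V).surjective z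
    exact ⟨z, (extEquiv k _ V).injective (by rw [← app_extEquiv, hz, LinearEquiv.map_smul])⟩

/-- The presheaf map `⋀ᵏ M₀ ⟶ ⋀ᵏ M₀ ⊗ L` given by a section of `L`. -/
def wedgeTensor (t : Sec (pre L) V) : Sec (extPre k (pre M₀)) V →ₗ[Γ(X, V)] Sec (pre (tensor
    (ext k M₀) L)) V :=
  (app (toSheafify (presheafTensor (ext k M₀) L)) V) ∘ₗ (tensorEquiv (ext k M₀) L V).toLinearMap ∘ₗ
    ((TensorProduct.mk Γ(X, V) _ _).flip t) ∘ₗ app (toSheafify (extPre k (pre M₀))) V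

lemma wedgeTensor_apply (t : Sec (pre L) V) (w : Sec (extPre k (pre M₀)) V) :
   wedgeTensor t w = app (toSheafify (presheafTensor (ext k M₀) L)) V (tensorEquiv (ext k M₀) L V
     (app (toSheafify (extPre k (pre M₀))) V w ⊗ₜ t)) := rfl

lemma res_wedgeTensor (h : W ≤ V) (t : Sec (pre L) V) (w : Sec (extPre k (pre M₀)) V) :
    res h (wedgeTensor t w) = wedgeTensor (res h t) (res h w) := by
  have h1 := res_app (toSheafify (presheafTensor (ext k M₀) L)) h (tensorEquiv (ext k M₀) L V
     (app (toSheafify (extPre k (pre M₀))) V w ⊗ₜ t))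
  rw [res_tensorEquiv_tmul, res_app (toSheafify (extPre k (pre M₀)))] at h1
  exact h1

/-- The morphism `⋀ᵏ M₀ ⊗ L ⟶ j_* ⋀ᵏ E ⊗ L`. -/
def wedgeTensorMap (ε : M₀ ⟶ (pushforward j).obj E) (k : ℕ) (L : X.Modules) :
    tensor (ext k M₀) L ⟶ tensor ((pushforward j).obj (ext k E)) L :=
  (sheafify X).map (presheafTensorMap (wedgePushHom j ε k) (𝟙 L))

lemma app_wedgeTensorMap (w : Sec (extPre k (pre M₀)) V) (t : Sec (pre L) V) :
    app (preHom (wedgeTensorMap ε k L)) V (wedgeTensor t w) =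
      app (toSheafify (presheafTensor ((pushforward j).obj (ext k E)) L)) V (tensorEquiv _ L V
       (app (preHom (wedgePushHom j ε k)) V (app (toSheafify (extPre k (pre M₀))) V w) ⊗ₜ t)) := by
  rw [wedgeTensor_apply]
  refine (app_sheafify_map _ _).trans ?_
  rw [app_presheafTensorMap_tmul]
  rfl

/-- The cokernel of `⋀ᵏ φ`. -/
abbrev wedgeCoker (k : ℕ) (φ : M₁ ⟶ M₀) : X.Modules := cokernel ((exteriorPower k).map φ)

/-- The projection to the cokernel of `⋀ᵏ φ`. -/
abbrev wedgeπ (k : ℕ) (φ : M₁ ⟶ M₀) : ext k M₀ ⟶ wedgeCoker k φ := cokernel.π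
    ((exteriorPower k).map φ)

/-- The morphism `⋀ᵏ M₀ ⊗ L ⟶ Coker ⋀ᵏ φ` given by a function `L ⟶ 𝒪_X`. -/
abbrev wedgeContract (k : ℕ) (φ : M₁ ⟶ M₀) (μ : L ⟶ structureSheaf X) :
   tensor (ext k M₀) L ⟶ wedgeCoker k φ := tensorContract (wedgeπ k φ) μ

/-- The class in `Coker ⋀ᵏ φ` of a section of the presheaf exterior power. -/
def wedgeClass (k : ℕ) (φ : M₁ ⟶ M₀) (V : X.Opens) : Sec (extPre k (pre M₀)) V →ₗ[Γ(X, V)] Sec (pre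
    (wedgeCoker k φ)) V :=
  app (preHom (wedgeπ k φ)) V ∘ₗ app (toSheafify (extPre k (pre M₀))) V

lemma wedgeClass_map (z : Sec (extPre k (pre M₁)) V) :
   wedgeClass k φ V (app (extMap k (preHom φ)) V z) = 0 := by
  have h1 : (sheafify X).map (extMap k (preHom φ)) ≫ wedgeπ k φ = 0 := cokernel.condition _
  rw [wedgeClass, LinearMap.comp_apply, ← app_sheafify_map, ← app_comp, ← preHom_comp, h1]
  rfl

lemma exists_res_wedgeClass (s : Sec (pre (wedgeCoker k φ)) U) {x : X} (hx : x ∈ U) :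
    ∃ (V : X.Opens) (hV : V ≤ U) (w : Sec (extPre k (pre M₀)) V), x ∈ V ∧
      wedgeClass k φ V w = res hV s := by
  have : Epi (wedgeπ k φ) := coequalizer.π_epi
  obtain ⟨V, hV, t, hxV, ht⟩ := exists_app_eq_of_epi (wedgeπ k φ) s hx
  obtain ⟨W, hW, w, hxW, hw⟩ := toSheafify_lift (extPre k (pre M₀)) t hxV
  refine ⟨W, hW.trans hV, w, hxW, ?_⟩
  rw [wedgeClass, LinearMap.comp_apply, hw, ← res_app, ht, res_res]

lemma exists_res_map_of_wedgeClass_eq_zero (w : Sec (extPre k (pre M₀)) U) (h :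
    wedgeClass k φ U w = 0)
    {x : X} (hx : x ∈ U) : ∃ (V : X.Opens) (hV : V ≤ U) (z : Sec (extPre k (pre M₁)) V), x ∈ V ∧
      app (extMap k (preHom φ)) V z = res hV w := by
  obtain ⟨V, hV, y, hxV, hy⟩ := exists_app_eq_of_exact (ShortComplex.mk ((exteriorPower k).map φ)
    (cokernel.π ((exteriorPower k).map φ)) (cokernel.condition _))
      (ShortComplex.exact_cokernel _) _ h hx
  obtain ⟨W, hW, z, hxW, hz⟩ := toSheafify_lift (extPre k (pre M₁)) y hxV
  have h1 : app (toSheafify (extPre k (pre M₀))) W (app (extMap k (preHom φ)) W z -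
      res (hW.trans hV) w) = 0 := by
    rw [map_sub, ← app_sheafify_map, hz, sub_eq_zero]
    refine (res_app (preHom ((exteriorPower k).map φ)) hW y).symm.trans ((congrArg _ hy).trans ?_)
    exact (res_res hV hW _).trans (res_app _ _ _)
  obtain ⟨W', hW', hxW', h2⟩ := toSheafify_res_eq _ _ h1 hxW
  refine ⟨W', (hW'.trans hW).trans hV, res hW' z, hxW', ?_⟩
  rwa [map_sub, sub_eq_zero, res_res, res_app] at h2

lemma app_wedgeContract (w : Sec (extPre k (pre M₀)) V) (t : Sec (pre L) V) :
    app (preHom (wedgeContract k φ μ)) V (wedgeTensor t w) =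
     (ringEquiv V).symm (app (preHom μ) V t) • wedgeClass k φ V w :=
  app_tensorContract _ _ _ _

lemma exists_res_wedgeTensor {V₀ : X.Opens} {t : Sec (pre L) V₀}
    (ht : ∀ V (h : V ≤ V₀), IsAffineOpen V → Function.Surjective fun r : Γ(X, V) => r • res h t)
    (z : Sec (pre (tensor (ext k M₀) L)) U) {x : X} (hx : x ∈ U) (hxV : x ∈ V₀) :
    ∃ (V : X.Opens) (hV : V ≤ U) (hV₀ : V ≤ V₀) (w : Sec (extPre k (pre M₀)) V), x ∈ V ∧
      wedgeTensor (res hV₀ t) w = res hV z := by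
  obtain ⟨V, hV, hV₀, m, hxV, -, hm⟩ := exists_tensor_eq z hx hxV t ht
  obtain ⟨W, hW, w, hxW, hw⟩ := toSheafify_lift (extPre k (pre M₀)) m hxV
  refine ⟨W, hW.trans hV, hW.trans hV₀, w, hxW, ?_⟩
  rw [wedgeTensor_apply, hw, ← res_res hV₀ hW, ← res_tensorEquiv_tmul, ← res_app, hm]
  exact res_res hV hW z

/-- Two sheafifications, that of the tensor product and that of `⋀ᵏ E`, are undone by shrinking;
between them `t` is cancelled because it freely generates `L`. The final open set is affine so that
the chart properties apply to it. -/
lemma IsWedgeChart.exists_res_of_app_wedgeTensor_eq_zero [IsClosedImmersion j] {V₀ : X.Opens}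
    {t : Sec (pre L) V₀} {g : Γ(X, V₀)}
    (h : ∀ V (hV : V ≤ V₀), IsAffineOpen V → IsWedgeChart j i φ ε μ k r V (res hV t) (ringRes hV g))
    (hV₀ : V ≤ V₀) (w : Sec (extPre k (pre M₀)) V)
    (hw : app (preHom (wedgeTensorMap ε k L)) V (wedgeTensor (res hV₀ t) w) = 0)
    {x : X} (hx : x ∈ V) : ∃ (W : X.Opens) (hW : W ≤ V), x ∈ W ∧ IsAffineOpen W ∧
      wedgePush j ε k W (res hW w) = 0 := by
  rw [app_wedgeTensorMap] at hw
  obtain ⟨V₁, hV₁, hxV₁, h1⟩ := toSheafify_res_eq _ _ hw hx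
  obtain ⟨V₂, hV₂, hxV₂, hV₂₁⟩ := exists_isAffineOpen_mem_and_subset hxV₁
  replace hV₂₁ : V₂ ≤ V₁ := hV₂₁
  have hV₂V := hV₂₁.trans hV₁
  replace h1 := congrArg (res hV₂₁) h1
  rw [res_res, map_zero, res_tensorEquiv_tmul, res_res, LinearEquiv.map_eq_zero_iff] at h1
  replace h1 := TensorProduct.eq_zero_of_tmul_eq_zero _ (h V₂ (hV₂V.trans hV₀) hV₂).bijective _ h1
  rw [res_app, res_app] at h1
  replace h1 := congrArg (pushEquiv j (ext k E) V₂) h1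
  rw [app_wedgePushHom, map_zero] at h1
  obtain ⟨V₃, hV₃, hxV₃, h2⟩ := exists_res_pushforward_eq_zero j _ h1 hxV₂
  obtain ⟨V₄, hV₄, hxV₄, hV₄₃⟩ := exists_isAffineOpen_mem_and_subset hxV₃
  replace hV₄₃ : V₄ ≤ V₃ := hV₄₃
  refine ⟨V₄, (hV₄₃.trans hV₃).trans hV₂V, hxV₄, hV₄, ?_⟩
  replace h2 := congrArg (res (j.preimage_mono hV₄₃)) h2
  rwa [res_wedgePush j ε k hV₃, res_wedgePush j ε k hV₄₃, map_zero, res_res, res_res] at h2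

lemma app_wedgeTensor_eq_zero_of_res {U : X.Opens} {t : Sec (pre L) U} (w : Sec (extPre k
    (pre M₀)) U)
    (hw : wedgePush j ε k U w = 0) :
    app (preHom (wedgeTensorMap ε k L)) U (wedgeTensor t w) = 0 := by
  rw [app_wedgeTensorMap]
  have : app (preHom (wedgePushHom j ε k)) U (app (toSheafify (extPre k (pre M₀))) U w) = 0 := by
    apply (pushEquiv j (ext k E) U).injective
    rw [app_wedgePushHom, hw, map_zero, map_zero]
  rw [this, TensorProduct.zero_tmul, map_zero, map_zero]
  rfl

lemma app_toRestrictTo (s : Sec (pre M₀) U) : app (preHom (toRestrictTo i M₀)) U s =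
    app (toSheafify _) U (tensorEquiv M₀ _ U (s ⊗ₜ app (preHom (N := (pushforward i).obj
      (structureSheaf Z))
      (SheafOfModules.unitToPushforwardObjUnit i.toRingCatSheafHom)) U (ringEquiv U 1))) := rfl

lemma smul_unitToPushforward (c : Γ(X, U)) : pushEquiv i (structureSheaf Z) U (c •
      app (preHom (N := (pushforward i).obj (structureSheaf Z))
      (SheafOfModules.unitToPushforwardObjUnit i.toRingCatSheafHom)) U (ringEquiv U 1)) =
    ringEquiv _ ((i.app U).hom c) := by
  rw [← LinearMap.map_smul, ← LinearEquiv.map_smul, smul_eq_mul, mul_one]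
  exact app_unitToPushforward i U c

lemma smul_unitToPushforward_eq_zero_iff (c : Γ(X, U)) : (c •
      app (preHom (N := (pushforward i).obj (structureSheaf Z))
      (SheafOfModules.unitToPushforwardObjUnit i.toRingCatSheafHom)) U (ringEquiv U 1)) = 0 ↔
    (i.app U).hom c = 0 := by
  rw [← (pushEquiv i (structureSheaf Z) U).map_eq_zero_iff, smul_unitToPushforward,
    LinearEquiv.map_eq_zero_iff]

lemma smul_unitToPushforward_surjective (h : Function.Surjective (i.app U).hom) :
   Function.Surjective fun c : Γ(X, U) => c •
      app (preHom (N := (pushforward i).obj (structureSheaf Z))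
      (SheafOfModules.unitToPushforwardObjUnit i.toRingCatSheafHom)) U (ringEquiv U 1) := by
  intro s
  obtain ⟨c, hc⟩ := h ((ringEquiv _).symm (pushEquiv i (structureSheaf Z) U s))
  exact ⟨c, (pushEquiv i (structureSheaf Z) U).injective (by
    dsimp only
    rw [smul_unitToPushforward, hc, LinearEquiv.apply_symm_apply])⟩

/-- The hypotheses of `exists_shortExact` are checked on local representatives `w ⊗ t`, which
`wedgeContract` sends to `g ^ (k-1)` times the class of `w`. -/
theorem exists_wedge_shortExact [IsClosedImmersion j] (hk : 1 ≤ k)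
    (h : ∀ x : X, ∃ (V₀ : X.Opens) (t : Sec (pre L) V₀) (g : Γ(X, V₀)), x ∈ V₀ ∧
      ∀ V (hV : V ≤ V₀), IsAffineOpen V → IsWedgeChart j i φ ε μ k r V (res hV t) (ringRes hV g)) :
    ∃ (ι : tensor ((pushforward j).obj (ext k E)) L ⟶ wedgeCoker k φ)
      (w : ι ≫ toRestrictTo i (wedgeCoker k φ) = 0),
      (ShortComplex.mk ι (toRestrictTo i (wedgeCoker k φ)) w).ShortExact := by
  have hq : Epi (wedgeTensorMap ε k L) := by
    refine epi_of_locally _ fun U s x hx => ?_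
    obtain ⟨V₀, t, g, hxV₀, H⟩ := h x
    obtain ⟨V, hV, hVV₀, m, hxV, -, hm⟩ := exists_tensor_eq s hx hxV₀ t
      fun V hV hVa => (H V hV hVa).bijective.2
    obtain ⟨W, hW, v, hxW, hv⟩ := exists_res_pushforward_eq j (pushEquiv j _ V m) hxV
    obtain ⟨W', hW', hxW', hWW'⟩ := exists_isAffineOpen_mem_and_subset hxW
    replace hWW' : W' ≤ W := hWW'
    have hWV := hWW'.trans hW
    obtain ⟨w, hw⟩ := exteriorPower.mapSemilinear_surjective _ (H W'
      (hWV.trans hVV₀) hW').surjective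
      _ (H W' (hWV.trans hVV₀) hW').surjective_appPush k
      ((extEquiv k (pre E) _).symm (res (j.preimage_mono hWW') v))
    refine ⟨W', hWV.trans hV, wedgeTensor (res (hWV.trans hVV₀) t) (extEquiv k _ _ w), hxW', ?_⟩
    have h1 : app (preHom (wedgePushHom j ε k)) W' (app (toSheafify (extPre k (pre M₀))) W'
        (extEquiv k _ _ w)) = res hWV m := by
      apply (pushEquiv j (ext k E) W').injective
      rw [app_wedgePushHom, wedgePush_extEquiv, hw, LinearEquiv.apply_symm_apply, ← res_app, hv,
        res_res, pushEquiv_res]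
    rw [app_wedgeTensorMap, h1, ← res_res hVV₀ hWV, ← res_tensorEquiv_tmul, ← res_app, hm]
    exact res_res hV hWV s
  refine exists_shortExact (wedgeTensorMap ε k L) (wedgeContract k φ μ) _ ?_ ?_ ?_ ?_
  -- Equality of kernels: locally, vanishing under either map says that `g ^ (k-1) • w` is in the
  -- image of `⋀ᵏ φ`.
  · intro U z
    constructor
    · intro hz
      refine sec_eq_of_locally_eq _ _ fun x hx => ?_
      obtain ⟨V₀, t, g, hxV₀, H⟩ := h x
      obtain ⟨V, hV, hVV₀, w, hxV, hw⟩ := exists_res_wedgeTensor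
        (fun V hV hVa => (H V hV hVa).bijective.2) z hx hxV₀
      replace hz := congrArg (res hV) hz
      rw [res_app, ← hw, map_zero] at hz
      obtain ⟨W, hW, hxW, hWa, h1⟩ := IsWedgeChart.exists_res_of_app_wedgeTensor_eq_zero H hVV₀ w
        hz hxV
      have hc := H W (hW.trans hVV₀) hWa
      obtain ⟨y, hy⟩ := (hc.wedgePush_eq_zero_iff hk _).1 h1
      refine ⟨W, hW.trans hV, hxW, ?_⟩
      rw [map_zero, res_app, ← res_res hV hW, ← hw, res_wedgeTensor, app_wedgeContract, res_res,
        hc.app_eq, ← LinearMap.map_smul, ← hy, wedgeClass_map]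
    · intro hz
      refine sec_eq_of_locally_eq _ _ fun x hx => ?_
      obtain ⟨V₀, t, g, hxV₀, H⟩ := h x
      obtain ⟨V, hV, hVV₀, w, hxV, hw⟩ := exists_res_wedgeTensor
        (fun V hV hVa => (H V hV hVa).bijective.2) z hx hxV₀
      obtain ⟨V', hV', hxV', hVV'⟩ := exists_isAffineOpen_mem_and_subset hxV
      replace hVV' : V' ≤ V := hVV'
      replace hz := congrArg (res (hVV'.trans hV)) hz
      rw [res_app, ← res_res hV hVV', ← hw, map_zero, res_wedgeTensor, app_wedgeContract, res_res,
        (H V' (hVV'.trans hVV₀) hV').app_eq, ← LinearMap.map_smul] at hz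
      obtain ⟨W, hW, y, hxW, hy⟩ := exists_res_map_of_wedgeClass_eq_zero _ hz hxV'
      obtain ⟨W', hW', hxW', hWW'⟩ := exists_isAffineOpen_mem_and_subset hxW
      replace hWW' : W' ≤ W := hWW'
      have hWV := (hWW'.trans hW).trans hVV'
      refine ⟨W', hWV.trans hV, hxW', ?_⟩
      rw [map_zero, res_app, ← res_res hV hWV, ← hw, res_wedgeTensor]
      refine app_wedgeTensor_eq_zero_of_res _
        (((H W' (hWV.trans hVV₀) hW').wedgePush_eq_zero_iff hk _).2 ⟨res hWW' y, ?_⟩)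
      rw [← res_app, hy, res_res, map_smulₛₗ, res_res, map_pow]
      congr 2
      exact (congr($(X.presheaf.map_comp (homOfLE (hVV'.trans hVV₀)).op (homOfLE
        (hWW'.trans hW)).op).hom g)).symm
  -- The composite vanishes because `g ^ (k-1)` becomes zero in `i_* 𝒪_Z`.
  · intro U z
    refine sec_eq_of_locally_eq _ _ fun x hx => ?_
    obtain ⟨V₀, t, g, hxV₀, H⟩ := h x
    obtain ⟨V, hV, hVV₀, w, hxV, hw⟩ := exists_res_wedgeTensor
      (fun V hV hVa => (H V hV hVa).bijective.2) z hx hxV₀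
    obtain ⟨V', hV', hxV', hVV'⟩ := exists_isAffineOpen_mem_and_subset hxV
    replace hVV' : V' ≤ V := hVV'
    have hc := H V' (hVV'.trans hVV₀) hV'
    refine ⟨V', hVV'.trans hV, hxV', ?_⟩
    rw [map_zero, res_app, res_app, ← res_res hV hVV', ← hw, res_wedgeTensor, app_wedgeContract,
      res_res, hc.app_eq, app_toRestrictTo, TensorProduct.smul_tmul,
      (smul_unitToPushforward_eq_zero_iff _).2 ((hc.ker' _).2 dvd_rfl), TensorProduct.tmul_zero,
      map_zero, map_zero]
    rfl
  -- On affine opens `i_* 𝒪_Z` is cyclic on `1` with annihilator `(g ^ (k-1))`, so a section that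
  -- restricts to zero is locally `g ^ (k-1) • s'`. A representative `w` of `s'` gives the preimage
  -- `w ⊗ t`.
  · intro U s hs x hx
    obtain ⟨V₀, t, g, hxV₀, H⟩ := h x
    rw [app_toRestrictTo] at hs
    obtain ⟨V, hV, hxV, h1⟩ := toSheafify_res_eq _ _ hs hx
    obtain ⟨V', hV', hxV', hVV'⟩ := exists_isAffineOpen_mem_and_subset (U := V ⊓ V₀) ⟨hxV, hxV₀⟩
    have hV'V : V' ≤ V := fun z hz => (hVV' hz).1
    have hV'V₀ : V' ≤ V₀ := fun z hz => (hVV' hz).2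
    have hc := H V' hV'V₀ hV'
    replace h1 := congrArg (res hV'V) h1
    rw [res_res, map_zero, res_tensorEquiv_tmul, LinearEquiv.map_eq_zero_iff, res_app,
      res_ringEquiv,
      map_one] at h1
    obtain ⟨s', hs'⟩ := TensorProduct.exists_eq_smul_of_tmul_eq_zero _
      (smul_unitToPushforward_surjective hc.surjective') (ringRes hV'V₀ g ^ (k - 1))
      (fun c hc' => (hc.ker' c).1 ((smul_unitToPushforward_eq_zero_iff _).1 hc'))
      ((smul_unitToPushforward_eq_zero_iff _).2 ((hc.ker' _).2 dvd_rfl)) _ h1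
    obtain ⟨W, hW, w, hxW, hw⟩ := exists_res_wedgeClass s' hxV'
    refine ⟨W, (hW.trans hV'V).trans hV, wedgeTensor (res (hW.trans hV'V₀) t) w, hxW, ?_⟩
    rw [app_wedgeContract, ← res_res (hV'V.trans hV) hW, hs', map_smulₛₗ, hw, ← hc.app_eq,
      ← res_res hV'V₀ hW, ← res_app]
    rfl
  · intro U s x hx
    obtain ⟨V₀, t, g, hxV₀, H⟩ := h x
    obtain ⟨V, hV, hVV₀, m, hxV, hVa, hm⟩ := exists_tensor_eq s hx hxV₀
      (app (preHom (N := (pushforward i).obj (structureSheaf Z))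
      (SheafOfModules.unitToPushforwardObjUnit i.toRingCatSheafHom)) V₀ (ringEquiv V₀ 1))
      fun V hV hVa => by
        rw [res_app, res_ringEquiv, map_one]
        exact smul_unitToPushforward_surjective (H V hV hVa).surjective'
    refine ⟨V, hV, m, hxV, ?_⟩
    rw [res_app, res_ringEquiv, map_one] at hm
    rw [app_toRestrictTo, hm]
    rfl

end

end AlgebraicGeometry.Scheme.Modules

/-! ### Local bases and exactness on sections -/

section

variable {R S F₁ F₀ E : Type*} [CommRing R] [CommRing S] [AddCommGroup F₁] [Module R F₁]
  [AddCommGroup F₀] [Module R F₀] [AddCommGroup E] [Module S E]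

/-- A criterion with finitely many conditions: modulo the elements `b j - ∑ c j i • e i`, every `y`
is a combination of the `e i`. If `ε y = 0`, its coefficients are multiples of `g`, so the elements
`g • e i` account for the rest. -/
theorem LinearMap.eq_zero_iff_of_presentation {ι κ : Type*} [Fintype ι] [Fintype κ] (π : R →+* S)
    (g : R) (hg : ∀ x, π x = 0 ↔ g ∣ x) (φ : F₁ →ₗ[R] F₀) (ε : F₀ →ₛₗ[π] E)
    (hφ : ∀ z, ε (φ z) = 0) (b : κ → F₀)
    (hb : Function.Surjective fun c : κ → R => ∑ i, c i • b i) (e : ι → F₀)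
    (he : Function.Injective fun c : ι → S => ∑ i, c i • ε (e i)) (c : κ → ι → R)
    (hc : ∀ j, b j - ∑ i, c j i • e i ∈ LinearMap.range φ)
    (hge : ∀ i, g • e i ∈ LinearMap.range φ) (y : F₀) : ε y = 0 ↔ ∃ z, φ z = y := by
  constructor
  · intro hy
    obtain ⟨a, rfl⟩ := hb y
    dsimp only at hy ⊢
    have h1 : ∑ j, a j • b j = ∑ j, a j • (b j - ∑ i, c j i • e i) +
        ∑ i, (∑ j, a j * c j i) • e i := by
      simp only [smul_sub, Finset.sum_sub_distrib, Finset.smul_sum, smul_smul, Finset.sum_smul]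
      rw [Finset.sum_comm (γ := ι), sub_add_cancel]
    have h2 : ∑ j, a j • (b j - ∑ i, c j i • e i) ∈ LinearMap.range φ :=
      sum_mem fun j _ => Submodule.smul_mem _ _ (hc j)
    obtain ⟨z, hz⟩ := h2
    have h3 : ∀ i, π (∑ j, a j * c j i) = 0 := by
      refine congrFun (he ?_ : (fun i => π (∑ j, a j * c j i)) = fun _ => 0)
      rw [h1, map_add, ← hz, hφ, zero_add, map_sum] at hy
      simp only [map_smulₛₗ] at hy
      simpa using hy
    change _ ∈ LinearMap.range φ
    rw [h1, ← hz]
    refine add_mem ⟨z, rfl⟩ (sum_mem fun i _ => ?_)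
    obtain ⟨q, hq⟩ := (hg _).1 (h3 i)
    rw [hq, mul_comm, mul_smul]
    exact Submodule.smul_mem _ _ (hge i)
  · rintro ⟨z, rfl⟩
    exact hφ z

end

namespace AlgebraicGeometry.Scheme

namespace Sec

variable {X : Scheme.{u}} {P Q : X.PresheafOfModules} {U V : X.Opens}

/-- The sections `e i` over `U` restrict to a basis over every smaller open set. -/
def IsBasis {ι : Type*} [Fintype ι] (e : ι → Sec P U) : Prop :=
  ∀ V (h : V ≤ U), Function.Bijective fun c : ι → Γ(X, V) => ∑ i, c i • res h (e i)

lemma IsBasis.res {ι : Type*} [Fintype ι] {e : ι → Sec P U} (he : IsBasis e) (h : V ≤ U) :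
    IsBasis fun i => res h (e i) := by
  intro W hW
  simp only [res_res]
  exact he W _

/-- The basis of the sections over `V`. -/
def IsBasis.basis {ι : Type*} [Fintype ι] {e : ι → Sec P U} (he : IsBasis e) (h : V ≤ U) :
    Module.Basis ι Γ(X, V) (Sec P V) :=
  .ofEquivFun (LinearEquiv.ofBijective (Fintype.linearCombination Γ(X, V) fun i => Sec.res h (e i))
    (he V h)).symm

end Sec

namespace Modules

open Sec

variable {X Y : Scheme.{u}} {M N : X.Modules} {U V : X.Opens}

lemma isBasis_of_biproduct {ι : Type*} [Fintype ι] [DecidableEq ι] {M : ι → X.Modules} {N :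
    X.Modules}
    (a : ∀ i, M i ⟶ N) (p : ∀ i, N ⟶ M i) (hap : ∀ i, a i ≫ p i = 𝟙 _)
    (hap' : ∀ i j, i ≠ j → a i ≫ p j = 0)
    (h : ∀ V (s : Sec (pre N) V), ∑ i, app (preHom (a i)) V (app (preHom (p i)) V s) = s) (t : ∀ i,
      Sec (pre (M i)) U)
    (ht : ∀ i V (h : V ≤ U), Function.Bijective fun c : Γ(X, V) => c • res h (t i)) :
    IsBasis fun i => app (preHom (a i)) U (t i) := by
  have h1 : ∀ i V (s : Sec (pre (M i)) V), app (preHom (p i)) V (app (preHom (a i)) V s) = s := by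
    intro i V s
    rw [← app_comp, ← preHom_comp, hap]; rfl
  have h2 : ∀ i j V (s : Sec (pre (M i)) V), i ≠ j → app (preHom (p j)) V (app (preHom
    (a i)) V s) = 0 := by
    intro i j V s hij
    rw [← app_comp, ← preHom_comp, hap' i j hij]; rfl
  intro V hV
  have key : ∀ (c : ι → Γ(X, V)) j, app (preHom (p j)) V (∑ i, c i • res hV (app (preHom (a i)) U
    (t i))) =
      c j • res hV (t j) := by
    intro c j
    rw [map_sum, Finset.sum_eq_single j]
    · rw [res_app, LinearMap.map_smul, h1]
    · intro i _ hij
      rw [res_app, LinearMap.map_smul, h2 i j V _ hij, smul_zero]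
    · simp
  constructor
  · intro c c' hcc
    ext1 j
    apply (ht j V hV).1
    dsimp only at hcc ⊢
    rw [← key, ← key, hcc]
  · intro s
    choose c hc using fun i => (ht i V hV).2 (app (preHom (p i)) V s)
    refine ⟨c, ?_⟩
    rw [← h V s]
    refine Finset.sum_congr rfl fun i _ => ?_
    rw [← hc, LinearMap.map_smul, res_app]

lemma app_add (φ ψ : M ⟶ N) (s : Sec (pre M) U) :
   app (preHom (φ + ψ)) U s = app (preHom φ) U s + app (preHom ψ) U s := rfl

lemma app_sum {ι : Type*} (T : Finset ι) (φ : ι → (M ⟶ N)) (s : Sec (pre M) U) :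
   app (preHom (∑ i ∈ T, φ i)) U s = ∑ i ∈ T, app (preHom (φ i)) U s := by
  classical
  induction T using Finset.induction_on with
  | empty => simp
  | insert i T hi ih => rw [Finset.sum_insert hi, Finset.sum_insert hi, app_add, ih]

lemma isBasis_biproduct {ι : Type} [Fintype ι] [DecidableEq ι] (M : ι → X.Modules)
    (t : ∀ i, Sec (pre (M i)) U)
    (ht : ∀ i V (h : V ≤ U), Function.Bijective fun c : Γ(X, V) => c • res h (t i)) :
    IsBasis fun i => app (preHom (biproduct.ι M i)) U (t i) := by
  refine isBasis_of_biproduct _ (biproduct.π M) (fun i => biproduct.ι_π_self M i)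
    (fun i j hij => biproduct.ι_π_ne M hij) (fun V s => ?_) t ht
  have h1 := congrArg (fun φ : _ ⟶ ⨁ M => app (preHom φ) V s) (biproduct.total (f := M))
  rw [app_sum] at h1
  exact h1

lemma IsBasis.of_iso {ι : Type*} [Fintype ι] {e : ι → Sec (pre M) U} (he : IsBasis e) (φ : M ≅ N) :
    IsBasis fun i => app (preHom φ.hom) U (e i) := by
  intro V hV
  have hb : Function.Bijective (app (preHom φ.hom) V) := by
    refine Function.bijective_iff_has_inverse.2 ⟨app (preHom φ.inv) V, fun s => ?_, fun s => ?_⟩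
    · rw [← app_comp, ← preHom_comp, φ.hom_inv_id]; rfl
    · rw [← app_comp, ← preHom_comp, φ.inv_hom_id]; rfl
  convert hb.comp (he V hV) using 1
  ext c
  simp only [Function.comp_apply, map_sum, map_smulₛₗ, res_app, RingHom.id_apply]

lemma exists_isBasis_free (r : ℕ) : ∃ e : Fin r → Sec (pre (SheafOfModules.free (R :=
    X.ringCatSheaf)
    (ULift.{u} (Fin r)) : X.Modules)) ⊤, IsBasis e := by
  have h1 := isBasis_biproduct (X := X) (U := ⊤) (fun _ : Fin r => structureSheaf X)
    (fun _ => ringEquiv ⊤ 1)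
    (fun i V h => by
      convert (ringEquiv V).bijective using 1
      ext c
      rw [res_ringEquiv, map_one, ← LinearEquiv.map_smul, smul_eq_mul, mul_one])
  refine ⟨_, IsBasis.of_iso h1 ((biproduct.isoCoproduct _) ≪≫ Sigma.whiskerEquiv (f := fun _ :
    Fin r => structureSheaf X)
    (g := fun _ : ULift.{u} (Fin r) => structureSheaf X) Equiv.ulift.symm (fun _ => Iso.refl _))⟩

/-- Sections of a restriction. -/
def restrictEquiv (M : X.Modules) (U : X.Opens) (W : U.toScheme.Opens) :
    Sec (pre (M.restrict U.ι)) W ≃+ Sec (pre M) (U.ι ''ᵁ W) := AddEquiv.refl _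

lemma restrictEquiv_smul (W : U.toScheme.Opens) (r : Γ(X, U.ι ''ᵁ W)) (s : Sec (pre
    (M.restrict U.ι)) W) :
    restrictEquiv M U W ((U.ι.appIso W).hom r • s) = r • restrictEquiv M U W s := by
  change (U.ι.appIso W).inv ((U.ι.appIso W).hom r) • restrictEquiv M U W s = _
  rw [← CommRingCat.comp_apply, Iso.hom_inv_id]; rfl

lemma restrictEquiv_res {W W' : U.toScheme.Opens} (h : W' ≤ W) (s : Sec (pre (M.restrict U.ι)) W) :
    restrictEquiv M U W' (res h s) = res (U.ι.image_mono h) (restrictEquiv M U W s) := rfl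

lemma exists_isBasis_of_restrict {U : X.Opens} {ι : Type*} [Fintype ι]
    {e : ι → Sec (pre (M.restrict U.ι)) ⊤} (he : IsBasis e) :
    ∃ e' : ι → Sec (pre M) U, IsBasis e' := by
  suffices ∃ e' : ι → Sec (pre M) (U.ι ''ᵁ ⊤), IsBasis e' by
    rwa [Scheme.Opens.ι_image_top] at this
  refine ⟨fun i => restrictEquiv M U ⊤ (e i), fun V hV => ?_⟩
  obtain ⟨W, rfl⟩ : ∃ W : U.toScheme.Opens, V = U.ι ''ᵁ W := ⟨U.ι ⁻¹ᵁ V, by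
    rw [Scheme.Opens.ι_image_top] at hV
    rw [Scheme.Hom.image_preimage_eq_opensRange_inf]
    simpa using hV⟩
  have h1 : Function.Bijective (U.ι.appIso W).hom := ConcreteCategory.bijective_of_isIso _
  have h2 : Function.Bijective fun c : ι → Γ(X, U.ι ''ᵁ W) => fun i => (U.ι.appIso W).hom (c i) :=
    ⟨fun c c' h => funext fun i => h1.1 (congrFun h i), fun c => by
      choose c' hc' using fun i => h1.2 (c i)
      exact ⟨c', funext hc'⟩⟩
  convert (restrictEquiv M U W).bijective.comp ((he W le_top).comp h2) using 1
  ext c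
  simp only [Function.comp_apply]
  rw [map_sum]
  refine Finset.sum_congr rfl fun i _ => ?_
  rw [restrictEquiv_smul, restrictEquiv_res]

lemma IsVectorBundle.exists_isBasis {r : ℕ} (hM : IsVectorBundle M r) (x : X) :
    ∃ (U : X.Opens) (e : Fin r → Sec (pre M) U), x ∈ U ∧ IsBasis e := by
  obtain ⟨U, hxU, ⟨φ⟩⟩ := hM x
  obtain ⟨e, he⟩ := exists_isBasis_free (X := U) r
  obtain ⟨e', he'⟩ := exists_isBasis_of_restrict (IsBasis.of_iso he φ.symm)
  exact ⟨U, e', hxU, he'⟩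

end Modules

end AlgebraicGeometry.Scheme

namespace AlgebraicGeometry.Scheme.Modules

open Sec

variable {X Y : Scheme.{u}} {M N : X.Modules} {U V : X.Opens}

section

variable (j : Y ⟶ X) [IsClosedImmersion j] {E : Y.Modules} {r : ℕ}

/-- Off the image of `j` the preimage is empty and its ring of sections is zero, so the zero family
is a basis of any length. -/
lemma IsVectorBundle.exists_isBasis_preimage (hE : IsVectorBundle E r) {x : X} (hx : x ∈ U) :
    ∃ V ≤ U, x ∈ V ∧ ∃ e : Fin r → Sec (pre E) (j ⁻¹ᵁ V), IsBasis e := by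
  by_cases hxj : x ∈ Set.range j
  · obtain ⟨y, rfl⟩ := hxj
    obtain ⟨W, e, hyW, he⟩ := hE.exists_isBasis y
    obtain ⟨V, hV, hyV, hVW⟩ := exists_preimage_le_of_mem j hyW hx
    exact ⟨V, hV, hyV, _, he.res hVW⟩
  · obtain ⟨V, hV, hxV, h⟩ := exists_preimage_le j hx hxj
    refine ⟨V, hV, hxV, fun _ => 0, fun W hW => ?_⟩
    obtain rfl : W = ⊥ := le_bot_iff.1 (h ▸ hW)
    exact ⟨fun _ _ _ => Subsingleton.elim _ _, fun s => ⟨0, Subsingleton.elim _ _⟩⟩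

lemma exists_le_forall {ι : Type*} [Finite ι] {x : X} (hx : x ∈ U) (p : ι → X.Opens → Prop)
    (hp : ∀ i V W, W ≤ V → p i V → p i W) (h : ∀ i, ∃ V ≤ U, x ∈ V ∧ p i V) :
    ∃ V ≤ U, x ∈ V ∧ ∀ i, p i V := by
  cases nonempty_fintype ι
  choose V hV hxV hpV using h
  refine ⟨U ⊓ Finset.univ.inf V, inf_le_left, ⟨hx, ?_⟩, fun i => hp i _ _ (inf_le_right.trans
    (Finset.inf_le (Finset.mem_univ i))) (hpV i)⟩
  have : ∀ T : Finset ι, x ∈ T.inf V := by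
    classical
    intro T
    induction T using Finset.induction_on with
    | empty => trivial
    | insert i T hi ih => rw [Finset.inf_insert]; exact ⟨hxV i, ih⟩
  exact this _

variable {M₁ M₀ : X.Modules} {φ : M₁ ⟶ M₀} {ε : M₀ ⟶ (pushforward j).obj E}

/-- Exactness of sheaves lifts each section only on a neighbourhood depending on it. By
`LinearMap.eq_zero_iff_of_presentation` finitely many relations have to be lifted, so one
neighbourhood serves, and all smaller affine opens inherit exactness by restriction. -/
lemma exists_presentation_nhd (hw : φ ≫ ε = 0) (hS : (ShortComplex.mk φ ε hw).Exact) [Epi ε]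
    (hE : IsVectorBundle E r) {κ : Type*} [Fintype κ] {V₀ : X.Opens} {b : κ → Sec (pre M₀) V₀}
    (hb : IsBasis b) (g : Γ(X, V₀))
    (hj : ∀ V ≤ V₀, IsAffineOpen V → Function.Surjective (j.app V).hom)
    (hg : ∀ V (hV : V ≤ V₀), IsAffineOpen V → ∀ c, (j.app V).hom c = 0 ↔ ringRes hV g ∣ c)
    {x : X} (hx : x ∈ V₀) :
    ∃ V₁ ≤ V₀, x ∈ V₁ ∧ ∀ V ≤ V₁, IsAffineOpen V →
      (∀ y, appPush j ε V y = 0 ↔ ∃ z, app (preHom φ) V z = y) ∧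
      Function.Surjective (appPush j ε V) ∧
      Nonempty (Module.Basis (Fin r) Γ(Y, j ⁻¹ᵁ V) (Sec (pre E) (j ⁻¹ᵁ V))) := by
  obtain ⟨V₁, hV₁, hxV₁, e, he⟩ := hE.exists_isBasis_preimage j hx
  obtain ⟨V₂, hV₂, hxV₂, h2⟩ := exists_le_forall hxV₁
    (fun i V => ∃ (hV : V ≤ V₁) (t : Sec (pre M₀) V), appPush j ε V t = res (j.preimage_mono hV)
      (e i))
    (by
      rintro i V W hVW ⟨hV, t, ht⟩
      exact ⟨hVW.trans hV, res hVW t, by rw [← res_appPush, ht, res_res]⟩)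
    (fun i => by
      obtain ⟨V, hV, t, hxV, ht⟩ := exists_app_eq_of_epi ε ((pushEquiv j E V₁).symm (e i)) hxV₁
      exact ⟨V, hV, hxV, hV, t, ht⟩)
  choose hV₂' t ht using h2
  obtain ⟨V₃, hV₃, hxV₃, hV₃₂⟩ := exists_isAffineOpen_mem_and_subset hxV₂
  replace hV₃₂ : V₃ ≤ V₂ := hV₃₂
  have h30 := (hV₃₂.trans hV₂).trans hV₁
  -- Over an affine open the coefficients in the basis `e` of `E` lift from `Y` to `X`.
  have h3 : ∀ k, ∃ c : Fin r → Γ(X, V₃), appPush j ε V₃ (res h30 (b k) - ∑ i, c i • res hV₃₂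
    (t i)) = 0 := by
    intro k
    obtain ⟨c, hc⟩ := (he (j ⁻¹ᵁ V₃) (j.preimage_mono (hV₃₂.trans hV₂))).2 (appPush j ε V₃ (res h30
      (b k)))
    choose c' hc' using fun i => hj V₃ h30 hV₃ (c i)
    refine ⟨c', ?_⟩
    rw [map_sub, map_sum, sub_eq_zero, ← hc]
    refine Finset.sum_congr rfl fun i _ => ?_
    rw [map_smulₛₗ, hc', ← res_appPush, ht, res_res]
  choose c hc using h3
  have hex : ∀ y : Sec (pre M₀) V₃, appPush j ε V₃ y = 0 → ∃ V ≤ V₃, x ∈ V ∧ ∃ (hV : V ≤ V₃) (z :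
    Sec (pre M₁) V),
      app (preHom φ) V z = res hV y := by
    intro y hy
    obtain ⟨V, hV, z, hxV, hz⟩ := exists_app_eq_of_exact _ hS y ((pushEquiv j E V₃).injective
      (hy.trans (map_zero _).symm)) hxV₃
    exact ⟨V, hV, hxV, hV, z, hz⟩
  have hmono : ∀ (y : Sec (pre M₀) V₃) (V W : X.Opens), W ≤ V → (∃ (hV : V ≤ V₃) (z : Sec
    (pre M₁) V),
      app (preHom φ) V z = res hV y) → (∃ (hV : W ≤ V₃) (z : Sec (pre M₁) W),
      app (preHom φ) W z = res hV y) := by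
    rintro y V W hVW ⟨hV, z, hz⟩
    exact ⟨hVW.trans hV, res hVW z, by rw [← res_app, hz, res_res]⟩
  -- A common neighbourhood on which the relations between `b` and the lifts `t` come from `M₁`.
  obtain ⟨V₄, hV₄, hxV₄, h4⟩ := exists_le_forall hxV₃ _ (fun k => hmono _) (fun k => hex _ (hc k))
  -- Likewise for `g • t i`, which `ε` kills because `g` vanishes on `Y`.
  obtain ⟨V₅, hV₅, hxV₅, h5⟩ := exists_le_forall hxV₄
    (fun i V => ∃ (hV : V ≤ V₃) (z : Sec (pre M₁) V),
      app (preHom φ) V z = res hV (ringRes h30 g • res hV₃₂ (t i))) (fun k => hmono _) (fun i => by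
    obtain ⟨V, hV, hxV, h⟩ := hex (ringRes h30 g • res hV₃₂ (t i)) (by
      rw [map_smulₛₗ, (hg V₃ h30 hV₃ _).2 dvd_rfl, zero_smul])
    exact ⟨V ⊓ V₄, inf_le_right, ⟨hxV, hxV₄⟩, hmono _ _ _ inf_le_left h⟩)
  refine ⟨V₅, (hV₅.trans hV₄).trans h30, hxV₅, fun V hV hVa => ?_⟩
  have hV₃' : V ≤ V₃ := (hV.trans hV₅).trans hV₄
  have hV₀ := hV₃'.trans h30
  have hV₁' := (hV₃'.trans hV₃₂).trans hV₂
  have hεt : ∀ i, appPush j ε V (res (hV₃'.trans hV₃₂) (t i)) = res (j.preimage_mono hV₁') (e i) :=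
    by
    intro i
    rw [← res_appPush, ht, res_res]
  have hB := he (j ⁻¹ᵁ V) (j.preimage_mono hV₁')
  refine ⟨?_, ?_, ⟨he.basis (j.preimage_mono hV₁')⟩⟩
  · refine LinearMap.eq_zero_iff_of_presentation (j.app V).hom (ringRes hV₀ g) (hg V hV₀ hVa) (app
      (preHom φ) V)
      (appPush j ε V) (fun z => ?_) _ (hb V hV₀).2 (fun i => res (hV₃'.trans hV₃₂) (t i)) ?_
        (fun k i => ringRes hV₃' (c k i)) ?_ ?_
    · have := congrArg (fun q : M₁ ⟶ _ => pushEquiv j E V (app (preHom q) V z)) hw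
      exact this
    · simp only [hεt]
      exact hB.1
    · intro k
      obtain ⟨h', z, hz⟩ := h4 k
      refine ⟨res (hV.trans hV₅) z, ?_⟩
      rw [← res_app, hz, res_res, map_sub, map_sum, res_res]
      congr 1
      refine Finset.sum_congr rfl fun i _ => ?_
      rw [map_smulₛₗ, res_res]
    · intro i
      obtain ⟨h', z, hz⟩ := h5 i
      refine ⟨res hV z, ?_⟩
      rw [← res_app, hz, res_res, map_smulₛₗ, res_res]
      congr 1
      exact (congr($(X.presheaf.map_comp (homOfLE h30).op (homOfLE hV₃').op).hom g)).symm
  · intro s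
    obtain ⟨c, hc⟩ := hB.2 s
    choose c' hc' using fun i => hj V hV₀ hVa (c i)
    refine ⟨∑ i, c' i • res (hV₃'.trans hV₃₂) (t i), ?_⟩
    rw [map_sum, ← hc]
    refine Finset.sum_congr rfl fun i _ => ?_
    rw [map_smulₛₗ, hc', hεt]

end

end AlgebraicGeometry.Scheme.Modules

/-! ### Twisting sheaves and the ideal of a hypersurface -/

lemma Ideal.mem_map_span_singleton_iff {R S : Type*} [CommRing R] [CommRing S] (ρ : R →+* S) (a :
    R) (s : S) :
    s ∈ (Ideal.span {a}).map ρ ↔ ρ a ∣ s := by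
  rw [Ideal.map_span, Set.image_singleton, Ideal.mem_span_singleton]

namespace AlgebraicGeometry.Proj

open Scheme.Modules Scheme.Sec

variable {A : Type u} {σ : Type v} [CommRing A] [SetLike σ A] [AddSubgroupClass σ A]
variable {𝒜 : ℕ → σ} [GradedRing 𝒜]

section twistingSheaf

variable {a : ℤ} {U V : (Proj 𝒜).Opens}

/-- The value at a point of a section of `𝒪(a)`. -/
def twistedVal (s : Scheme.Sec (pre (twistingSheaf 𝒜 a)) U) (x : Proj 𝒜) (hx : x ∈ U) : Loc x :=
  (show twistedSections 𝒜 a U from s).1 ⟨x, hx⟩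

lemma isTwisted_twistedVal (s : Scheme.Sec (pre (twistingSheaf 𝒜 a)) U) : IsTwisted a
    (twistedVal s) :=
  isTwisted_iff.2 (show twistedSections 𝒜 a U from s).2

/-- The section of `𝒪(a)` given by a function of degree `a`. -/
def twistedSec (s : ∀ x ∈ U, Loc x) (hs : IsTwisted a s) : Scheme.Sec (pre (twistingSheaf 𝒜 a)) U :=
  show twistedSections 𝒜 a U from ⟨fun x => s x.1 x.2, isTwisted_iff.1 hs⟩

lemma twistedVal_ext {s t : Scheme.Sec (pre (twistingSheaf 𝒜 a)) U}
    (h : ∀ x hx, twistedVal s x hx = twistedVal t x hx) : s = t :=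
  Subtype.ext (funext fun x => h x.1 x.2)

lemma twistedVal_smul (c : Γ(Proj 𝒜, U)) (s : Scheme.Sec (pre (twistingSheaf 𝒜 a)) U) (x : Proj 𝒜)
    (hx : x ∈ U) :
    twistedVal (c • s) x hx = valAt x hx c * twistedVal s x hx := rfl

lemma twistedVal_add (s t : Scheme.Sec (pre (twistingSheaf 𝒜 a)) U) (x : Proj 𝒜) (hx : x ∈ U) :
    twistedVal (s + t) x hx = twistedVal s x hx + twistedVal t x hx := rfl

lemma twistedVal_res (h : V ≤ U) (s : Scheme.Sec (pre (twistingSheaf 𝒜 a)) U) (x : Proj 𝒜) (hx :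
    x ∈ V) :
    twistedVal (res h s) x hx = twistedVal s x (h hx) := rfl

/-- The generator `ℓ ^ a` of `𝒪(a)` where the linear form `ℓ` does not vanish. -/
def twistedGen (a : ℤ) {ℓ : A} (hℓ : ℓ ∈ 𝒜 1) (hU : U ≤ basicOpen 𝒜 ℓ) : Scheme.Sec (pre
    (twistingSheaf 𝒜 a)) U :=
  twistedSec (unitPow hU a) (isTwisted_unitPow hU hℓ a)

lemma smul_twistedGen_bijective (a : ℤ) {ℓ : A} (hℓ : ℓ ∈ 𝒜 1) (hU : U ≤ basicOpen 𝒜 ℓ) (h :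
    V ≤ U) :
    Function.Bijective fun c : Γ(Proj 𝒜, V) => c • res h (twistedGen a hℓ hU) := by
  constructor
  · intro c c' hc
    refine section_ext fun x hx => ?_
    have h1 := congrArg (fun s => twistedVal s x hx) hc
    exact (isUnit_unitPow hU a x (h hx)).mul_right_cancel h1
  · intro s
    refine ⟨ofTwisted _ ((isTwisted_twistedVal s).mul (isTwisted_unitPow (h.trans hU) hℓ (-a))
      (add_neg_cancel a)),
      twistedVal_ext fun x hx => ?_⟩
    dsimp only
    rw [twistedVal_smul, valAt_ofTwisted, mul_assoc, twistedVal_res]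
    refine (congrArg _ (unitPow_add (h.trans hU) (-a) a x hx)).trans ?_
    rw [neg_add_cancel, unitPow_zero, mul_one]

/-- Multiplication by a form of degree `-a` on sections of `𝒪(a)`. -/
def mulFormSec {e : ℕ} {g : A} (hg : g ∈ 𝒜 e) (he : (e : ℤ) + a = 0) (s : Scheme.Sec (pre
    (twistingSheaf 𝒜 a)) U) :
    Γ(Proj 𝒜, U) :=
  ofTwisted _ ((isTwisted_const hg U).mul (isTwisted_twistedVal s) he)

lemma valAt_mulFormSec {e : ℕ} {g : A} (hg : g ∈ 𝒜 e) (he : (e : ℤ) + a = 0) (s : Scheme.Sec (pre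
    (twistingSheaf 𝒜 a)) U)
    (x : Proj 𝒜) (hx : x ∈ U) : valAt x hx (mulFormSec hg he s) = algebraMap A
      (Loc x) g * twistedVal s x hx :=
  valAt_ofTwisted ..

/-- Multiplication by a form of degree `-a`, as a morphism `𝒪(a) ⟶ 𝒪`. -/
def mulForm {e : ℕ} {g : A} (hg : g ∈ 𝒜 e) (he : (e : ℤ) + a = 0) :
    twistingSheaf 𝒜 a ⟶ structureSheaf (Proj 𝒜) :=
  let m (U : (Proj 𝒜).Opens) : Scheme.Sec (pre (twistingSheaf 𝒜 a)) U →ₗ[Γ(Proj 𝒜, U)] Γ(Proj 𝒜,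
    U) :=
    { toFun s := mulFormSec hg he s
      map_add' s t := section_ext fun x hx => by
        rw [map_add, valAt_mulFormSec, valAt_mulFormSec, valAt_mulFormSec, twistedVal_add, mul_add]
      map_smul' c s := section_ext fun x hx => by
        rw [smul_eq_mul, map_mul, valAt_mulFormSec, valAt_mulFormSec, twistedVal_smul,
          mul_left_comm]
        rfl }
  ofPre (mkHom (fun U => (ringEquiv U).toLinearMap.comp (m U)) (fun {U V} h s => by
          refine (res_ringEquiv h (mulFormSec hg he s)).trans (congrArg (ringEquiv V) ?_)
          refine section_ext fun x hx => ?_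
          change _ = valAt x hx (mulFormSec hg he (res h s))
          rw [valAt_res, valAt_mulFormSec, valAt_mulFormSec, twistedVal_res]))

lemma app_mulForm {e : ℕ} {g : A} (hg : g ∈ 𝒜 e) (he : (e : ℤ) + a = 0) {ℓ : A} (hℓ : ℓ ∈ 𝒜 1)
    (hU : U ≤ basicOpen 𝒜 ℓ) : (ringEquiv U).symm (app (preHom (mulForm hg he)) U
      (twistedGen a hℓ hU)) =
      dehomog hℓ hg hU := by
  refine section_ext fun x hx => ?_
  change valAt x hx (mulFormSec hg he (twistedGen a hℓ hU)) = _
  rw [valAt_mulFormSec, valAt_dehomog, show -(e : ℤ) = a by omega]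
  rfl

lemma res_twistedGen (a : ℤ) {ℓ : A} (hℓ : ℓ ∈ 𝒜 1) (hU : U ≤ basicOpen 𝒜 ℓ) (h : V ≤ U) :
    res h (twistedGen a hℓ hU) = twistedGen a hℓ (h.trans hU) := rfl

lemma isBasis_splitBundle {m : ℕ} (a : Fin m → ℤ) {ℓ : A} (hℓ : ℓ ∈ 𝒜 1) (hU : U ≤ basicOpen 𝒜 ℓ) :
    IsBasis fun j => app (preHom (biproduct.ι (fun j => twistingSheaf 𝒜 (a j)) j)) U (twistedGen
      (a j) hℓ hU) :=
  isBasis_biproduct _ _ fun j _ h => smul_twistedGen_bijective (a j) hℓ hU h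

end twistingSheaf

section hypersurface

variable {d : ℕ} {f : A}

variable (𝒜) in
/-- The ideal sheaf of sections whose restriction to `D(ℓ)` is a multiple of `f / ℓ ^ d`. -/
def chartIdeal (hf : f ∈ 𝒜 d) {ℓ : A} (hℓ : ℓ ∈ 𝒜 1) : (Proj 𝒜).IdealSheafData :=
  (Scheme.IdealSheafData.ofIdealTop (X := (basicOpen 𝒜 ℓ).toScheme)
    (Ideal.span {(dehomog (U := (basicOpen 𝒜 ℓ).ι ''ᵁ ⊤) hℓ hf (by simp))})).map (basicOpen 𝒜 ℓ).ι

lemma mem_chartIdeal_iff (hf : f ∈ 𝒜 d) {ℓ : A} (hℓ : ℓ ∈ 𝒜 1) (U : (Proj 𝒜).affineOpens) (s :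
    Γ(Proj 𝒜, U)) :
    s ∈ (chartIdeal 𝒜 hf hℓ).ideal U ↔ dehomog (U := U.1 ⊓ basicOpen 𝒜 ℓ) hℓ hf inf_le_right ∣
      ringRes inf_le_left s := by
  have haff : IsAffineOpen (basicOpen 𝒜 ℓ) := isAffineOpen_basicOpen 𝒜 ℓ hℓ one_pos
  have h1 : IsAffineOpen (U.1 ⊓ basicOpen 𝒜 ℓ) := U.2.inf haff
  have h2 : (basicOpen 𝒜 ℓ).ι ''ᵁ ((basicOpen 𝒜 ℓ).ι ⁻¹ᵁ U.1) = U.1 ⊓ basicOpen 𝒜 ℓ := by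
    rw [Scheme.Hom.image_preimage_eq_opensRange_inf, Scheme.Opens.opensRange_ι, inf_comm]
  have h3 : IsAffineOpen ((basicOpen 𝒜 ℓ).ι ⁻¹ᵁ U.1) := by
    rw [← Scheme.Hom.isAffineOpen_iff_of_isOpenImmersion (basicOpen 𝒜 ℓ).ι, h2]
    exact h1
  have : IsAffine (basicOpen 𝒜 ℓ).toScheme := haff
  have : QuasiCompact (basicOpen 𝒜 ℓ).ι := inferInstance
  rw [chartIdeal, Scheme.IdealSheafData.ideal_map _ _ U h3, Ideal.mem_comap,
    Scheme.IdealSheafData.ofIdealTop_ideal]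
  refine (Ideal.mem_map_span_singleton_iff _ _ _).trans ?_
  -- The two open sets are equal but not definitionally so; generalizing over `W` permits
  -- substitution.
  suffices H : ∀ W (hW : W = U.1 ⊓ basicOpen 𝒜 ℓ),
    dehomog (U := W) hℓ hf (hW.le.trans inf_le_right) ∣ ringRes (hW.le.trans inf_le_left) s ↔
     dehomog (U := U.1 ⊓ basicOpen 𝒜 ℓ) hℓ hf inf_le_right ∣
      ringRes inf_le_left s by
    refine Iff.trans ?_ (H _ h2)
    have h4 := res_dehomog (V := (basicOpen 𝒜 ℓ).ι ''ᵁ ((basicOpen 𝒜 ℓ).ι ⁻¹ᵁ U.1)) hℓ hf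
      (U := (basicOpen 𝒜 ℓ).ι ''ᵁ ⊤) (by simp) ((basicOpen 𝒜 ℓ).ι.image_mono le_top)
    rw [← h4]
    rfl
  rintro _ rfl
  rfl

lemma res_dvd_res {X : Scheme.{u}} {U V : X.Opens} (h : V ≤ U) {a b : Γ(X, U)} (hab : a ∣ b) :
    ringRes h a ∣ ringRes h b := map_dvd _ hab

lemma mem_divisibleSections_iff {U : (Proj 𝒜).Opens} (s : Γ(Proj 𝒜, U)) :
    s ∈ divisibleSections 𝒜 f U ↔
    ∀ x hx, valAt x hx s ∈ Ideal.span {algebraMap A (Loc x) f} :=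
  ⟨fun h x hx => h ⟨x, hx⟩, fun h x => h x.1 x.2⟩

variable (f) in
lemma hypersurfaceIdeal_ideal_le (U : (Proj 𝒜).affineOpens) :
    (hypersurfaceIdeal 𝒜 f).ideal U ≤ divisibleSections 𝒜 f U :=
  Scheme.IdealSheafData.ideal_ofIdeals_le (fun U : (Proj 𝒜).affineOpens => divisibleSections 𝒜 f U)
    U

/-- `hypersurfaceIdeal` is the largest ideal sheaf inside `divisibleSections`, so showing that it is
big enough requires exhibiting some ideal sheaf there. The meet of the chart ideals is one, since
the charts cover and divisibility is tested at points. -/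
lemma iInf_chartIdeal_le (hf : f ∈ 𝒜 d) {ι : Type*} [Finite ι] {ℓ : ι → A} (hℓ : ∀ i, ℓ i ∈ 𝒜 1)
    (hcov : ∀ x : Proj 𝒜, ∃ i, x ∈ basicOpen 𝒜 (ℓ i)) :
    ⨅ i, chartIdeal 𝒜 hf (hℓ i) ≤ hypersurfaceIdeal 𝒜 f := by
  refine Scheme.IdealSheafData.le_ofIdeals_iff.2 fun U => ?_
  intro t ht
  rw [mem_divisibleSections_iff]
  intro x hx
  rw [Scheme.IdealSheafData.ideal_iInf, iInf_apply, Ideal.mem_iInf] at ht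
  obtain ⟨i, hi⟩ := hcov x
  obtain ⟨c, hc⟩ := (mem_chartIdeal_iff hf (hℓ i) U t).1 (ht i)
  have h2 := congrArg (valAt x (⟨hx, hi⟩ : x ∈ U.1 ⊓ basicOpen 𝒜 (ℓ i))) hc
  rw [map_mul] at h2
  have h3 : valAt x hx t = _ := h2
  rw [h3]
  exact Ideal.mul_mem_right _ _ (valAt_dehomog_mem _ _ _ _ _)

lemma hypersurfaceι_app_surjective {V : (Proj 𝒜).Opens} (hVa : IsAffineOpen V) :
    Function.Surjective ((hypersurfaceι 𝒜 f).app V).hom :=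
  (hypersurfaceIdeal 𝒜 f).subschemeι_app_surjective ⟨V, hVa⟩

lemma hypersurfaceι_app_eq_zero_iff {V : (Proj 𝒜).Opens} (hVa : IsAffineOpen V) (s : Γ(Proj 𝒜, V)) :
    ((hypersurfaceι 𝒜 f).app V).hom s = 0 ↔ s ∈ (hypersurfaceIdeal 𝒜 f).ideal ⟨V, hVa⟩ := by
  rw [← Scheme.IdealSheafData.ker_subschemeι_app]
  rfl

instance : IsClosedImmersion (hypersurfaceι 𝒜 f) :=
  inferInstanceAs (IsClosedImmersion (hypersurfaceIdeal 𝒜 f).subschemeι)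

variable [IsDomain A]

/-- Sections of the ideal are divisible by `f` at each point, hence multiples of `f / ℓ ^ d`.
Conversely such a multiple lies in every chart ideal, since `f / ℓ ^ d` and `f / ℓ' ^ d` divide one
another where both linear forms are invertible. -/
lemma mem_hypersurfaceIdeal_iff (hf : f ∈ 𝒜 d) (hf0 : f ≠ 0) {ι : Type*} [Finite ι] {ℓ : ι → A}
    (hℓ : ∀ i, ℓ i ∈ 𝒜 1)
    (hcov : ∀ x : Proj 𝒜, ∃ i, x ∈ basicOpen 𝒜 (ℓ i)) (i : ι) {V : (Proj 𝒜).Opens} (hVa :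
      IsAffineOpen V)
    (hV : V ≤ basicOpen 𝒜 (ℓ i)) (s : Γ(Proj 𝒜, V)) :
    s ∈ (hypersurfaceIdeal 𝒜 f).ideal ⟨V, hVa⟩ ↔ dehomog (hℓ i) hf hV ∣ s := by
  constructor
  · intro hs
    exact dehomog_dvd_of_divisible (hℓ i) hf hV hf0
      ((mem_divisibleSections_iff s).1 (hypersurfaceIdeal_ideal_le f ⟨V, hVa⟩ hs))
  · intro hs
    refine iInf_chartIdeal_le hf hℓ hcov ⟨V, hVa⟩ ?_
    rw [Scheme.IdealSheafData.ideal_iInf, iInf_apply, Ideal.mem_iInf]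
    intro i'
    rw [mem_chartIdeal_iff]
    have h2 := res_dvd_res (inf_le_left : V ⊓ basicOpen 𝒜 (ℓ i') ≤ V) hs
    rw [res_dehomog] at h2
    exact (dehomog_dvd_dehomog _ hf _ (hℓ i') _).trans h2

theorem exists_isWedgeChart (hf : f ∈ 𝒜 d) (hf0 : f ≠ 0) {ι : Type*} [Finite ι] {ℓ : ι → A} (hℓ :
    ∀ i, ℓ i ∈ 𝒜 1)
    (hcov : ∀ x : Proj 𝒜, ∃ i, x ∈ basicOpen 𝒜 (ℓ i)) {E : (hypersurface 𝒜 f).Modules} {r : ℕ}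
    (hE : IsVectorBundle E r) (F : MinimalFreeResolution 𝒜 ((pushforward
      (hypersurfaceι 𝒜 f)).obj E))
    (k : ℕ) (e : ℕ) (he : e = (k - 1) * d) (hfk : f ^ (k - 1) ∈ 𝒜 e) (a : ℤ) (ha : (e : ℤ) + a = 0)
      (x : Proj 𝒜) :
    ∃ (V₀ : (Proj 𝒜).Opens) (t : Scheme.Sec (pre (twistingSheaf 𝒜 a)) V₀) (g : Γ(Proj 𝒜, V₀)),
      x ∈ V₀ ∧
      ∀ V (hV : V ≤ V₀), IsAffineOpen V →
        IsWedgeChart (hypersurfaceι 𝒜 f) (hypersurfaceι 𝒜 (f ^ (k - 1))) (F.d 0) F.aug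
          (mulForm hfk ha) k r V
          (res hV t) (ringRes hV g) := by
  obtain ⟨i, hi⟩ := hcov x
  have hb := isBasis_splitBundle (F.deg 0) (hℓ i) (le_refl (basicOpen 𝒜 (ℓ i)))
  have hker : ∀ V (hV : V ≤ basicOpen 𝒜 (ℓ i)), IsAffineOpen V → ∀ c,
    ((hypersurfaceι 𝒜 f).app V).hom c = 0 ↔
      ringRes hV (dehomog (hℓ i) hf (le_refl (basicOpen 𝒜 (ℓ i)))) ∣ c := fun V hV hVa c => by
    rw [res_dehomog, hypersurfaceι_app_eq_zero_iff hVa,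
      mem_hypersurfaceIdeal_iff hf hf0 hℓ hcov i hVa hV]
  have := F.epi_aug
  obtain ⟨V₁, hV₁, hxV₁, h⟩ := exists_presentation_nhd
    (hypersurfaceι 𝒜 f) F.d_comp_aug F.exact_aug hE hb
    (dehomog (hℓ i) hf (le_refl (basicOpen 𝒜 (ℓ i)))) (fun V hV hVa => hypersurfaceι_app_surjective
      hVa) hker hi
  refine ⟨V₁, twistedGen a (hℓ i) hV₁, dehomog (hℓ i) hf hV₁, hxV₁, fun V hV hVa => ?_⟩
  obtain ⟨hex, hsurj, hbas⟩ := h V hV hVa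
  refine ⟨smul_twistedGen_bijective a (hℓ i) (hV.trans hV₁) le_rfl, ?_,
    hypersurfaceι_app_surjective hVa, ?_,
    hypersurfaceι_app_surjective hVa, ?_, ?_, ?_, hex, hsurj, hbas⟩
  -- The generator `ℓ ^ a` with `a = -(k-1)d` is sent to `f ^ (k-1) / ℓ ^ ((k-1)d)`, that is, `(f /
  -- ℓ ^ d) ^ (k-1)`.
  · rw [res_twistedGen, app_mulForm, res_dehomog, dehomog_pow (hℓ i) hf _ _ he]
  · rw [res_dehomog]
    intro c
    rw [hker V (hV.trans hV₁) hVa, res_dehomog]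
  · intro c
    rw [hypersurfaceι_app_eq_zero_iff hVa, mem_hypersurfaceIdeal_iff hfk
      (pow_ne_zero _ hf0) hℓ hcov i hVa (hV.trans hV₁),
      res_dehomog, dehomog_pow (hℓ i) hf _ _ he]
  · rw [res_dehomog]
    exact dehomog_mem_nonZeroDivisors _ _ _ hf0
  · exact Module.Projective.of_basis (hb.basis (hV.trans hV₁))

/-- The exact sequence relating `⋀ᵏ E`, `Coker ⋀ᵏ φ` and its restriction to `V(f ^ (k - 1))`. -/
theorem exists_wedgeCokernel_shortExact (hf : f ∈ 𝒜 d) (hf0 : f ≠ 0) {ι : Type*} [Finite ι] {ℓ :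
    ι → A} (hℓ : ∀ i, ℓ i ∈ 𝒜 1)
    (hcov : ∀ x : Proj 𝒜, ∃ i, x ∈ basicOpen 𝒜 (ℓ i)) {E : (hypersurface 𝒜 f).Modules} {r : ℕ}
    (hE : IsVectorBundle E r) (F : MinimalFreeResolution 𝒜 ((pushforward
      (hypersurfaceι 𝒜 f)).obj E))
    (k : ℕ) (hk : 1 ≤ k) :
    ∃ (ι : tensor ((pushforward (hypersurfaceι 𝒜 f)).obj ((exteriorPower k).obj E))
          (twistingSheaf 𝒜 (-(((k : ℤ) - 1) * d))) ⟶ wedgeCokernel F k)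
      (w : ι ≫ toRestrictTo (hypersurfaceι 𝒜 (f ^ (k - 1))) (wedgeCokernel F k) = 0),
      (ShortComplex.mk ι (toRestrictTo (hypersurfaceι 𝒜 (f ^ (k - 1)))
        (wedgeCokernel F k)) w).ShortExact :=
  exists_wedge_shortExact hk (exists_isWedgeChart hf hf0 hℓ hcov hE F k _ rfl
    (by simpa using SetLike.pow_mem_graded (k - 1) hf) _
    -- The natural-number `k - 1` in the exponent of `f` agrees with the integer one in the twist
    -- because `1 ≤ k`.
    (by rw [Nat.cast_mul, Nat.cast_sub hk, Nat.cast_one]; ring))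

end hypersurface

end AlgebraicGeometry.Proj

/-! ### The standard cover of projective space and the conclusion -/

/-- A prime containing all variables contains every polynomial without constant term, hence the
irrelevant ideal, which is excluded for points of `Proj`. -/
lemma MvPolynomial.exists_mem_basicOpen_X {K : Type u} [Field K] {N : ℕ} (x : projectiveSpace K N) :
    ∃ i, x ∈ Proj.basicOpen (homogeneousSubmodule (Fin (N + 1)) K) (X i) := by
  by_contra! h
  apply (Proj.prime x).not_irrelevant_le
  have hX : Ideal.span (X '' Set.univ) ≤ (Proj.prime x).asHomogeneousIdeal.toIdeal := by
    rw [Ideal.span_le]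
    rintro _ ⟨i, -, rfl⟩
    exact not_not.1 (h i)
  intro p hp
  refine hX (mem_ideal_span_X_image.2 fun m hm => ?_)
  by_contra! h0
  obtain rfl : m = 0 := Finsupp.ext fun i => h0 i trivial
  have h1 := (HomogeneousIdeal.mem_irrelevant_iff _ p).1 hp
  rw [GradedRing.proj_apply] at h1
  have h2 : homogeneousComponent 0 p = 0 := (decomposition.decompose'_apply p 0).symm.trans h1
  rw [homogeneousComponent_zero, C_eq_zero] at h2
  exact mem_support_iff.1 hm h2

end

theorem mainTheorem5 {K : Type u} [Field K] [IsAlgClosed K] [CharZero K]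
    (n d : ℕ) (hd : 0 < d)
    (f : MvPolynomial (Fin (n + 1 + 1)) K) (hf : f.IsHomogeneous d) (hf0 : f ≠ 0)
    (hX : Smooth (Proj.hypersurfaceι (MvPolynomial.homogeneousSubmodule (Fin (n + 1 + 1)) K) f ≫
      projectiveSpaceToSpec K (n + 1)))
    (E : (Proj.hypersurface (MvPolynomial.homogeneousSubmodule (Fin (n + 1 + 1)) K) f).Modules)
    (r : ℕ) (hE : Scheme.Modules.IsVectorBundle E r) (hACM : Proj.IsACM n E)
    (F : Proj.MinimalFreeResolution (MvPolynomial.homogeneousSubmodule (Fin (n + 1 + 1)) K)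
      ((Scheme.Modules.pushforward (Proj.hypersurfaceι _ f)).obj E))
    (s : ℕ) (hσ : Scheme.Modules.IsVectorBundle (Proj.sigma F) s)
    (k : ℕ) (hk : 1 ≤ k) (hkr : k ≤ r) (hks : k ≤ s) :
    ∃ (ι : Scheme.Modules.tensor
          ((Scheme.Modules.pushforward (Proj.hypersurfaceι _ f)).obj
            ((Scheme.Modules.exteriorPower k).obj E))
          (Proj.twistingSheaf _ (-(((k : ℤ) - 1) * d))) ⟶ Proj.wedgeCokernel F k)
      (w : ι ≫ Scheme.Modules.toRestrictTo (Proj.hypersurfaceι _ (f ^ (k - 1)))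
        (Proj.wedgeCokernel F k) = 0),
      (ShortComplex.mk ι (Scheme.Modules.toRestrictTo (Proj.hypersurfaceι _ (f ^ (k - 1)))
        (Proj.wedgeCokernel F k)) w).ShortExact :=
  Proj.exists_wedgeCokernel_shortExact (𝒜 := MvPolynomial.homogeneousSubmodule (Fin
    (n + 1 + 1)) K) hf hf0
    (ℓ := MvPolynomial.X) (fun i => MvPolynomial.isHomogeneous_X K i)
      MvPolynomial.exists_mem_basicOpen_X hE F k hk
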